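/- For positive integers $m$ and $n$, the knight graph of size $m \times n$ has as its vertices the cells $(x, y) \in \mathbb{Z}^2$ with $0 \le x \le n - 1$ and $0 \le y \le m - 1$, and two cells $(x', y')$ and $(x'', y'')$ are adjacent if and only if $\{|x' - x''|, |y' - y''|\} = \{1, 2\}$. A snake path (snake cycle) in a simple graph $G$ is a path (cycle) in $G$ which is also an induced subgraph of $G$; its length is the number of its edges. Theorem. There is an absolute constant $C$ such that the following holds for all positive integers $m$ and $n$. The greatest length $\ell$ of a snake path in the knight graph of size $m \times n$ satisfies $|\ell - mn/2| \le C(m + n)$. If $m \ge 3$ and $n \ge 3$, then snake cycles exist in this graph, and the greatest length $\ell'$ of such a cycle satisfies $|\ell' - mn/2| \le C(m + n)$. If $m < 3$ or $n < 3$, then this graph contains no snake cycle. -/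

import Mathlib

namespace Snake

/-- A snake path in a simple graph `G`: a finite subgraph of `G` which is a path (a tree in which
every vertex has degree at most two) and also an induced subgraph of `G`. -/
structure IsSnakePath {V : Type*} {G : SimpleGraph V} (P : G.Subgraph) : Prop where
  finite : P.verts.Finite
  isTree : P.coe.IsTree
  degree_le : ∀ v ∈ P.verts, (P.neighborSet v).encard ≤ 2
  isInduced : P.IsInduced

/-- A snake cycle in a simple graph `G`: a finite subgraph of `G` which is a cycle (it is nonempty
and connected, and every vertex has degree exactly two) and also an induced subgraph of `G`. -/
structure IsSnakeCycle {V : Type*} {G : SimpleGraph V} (P : G.Subgraph) : Prop where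
  finite : P.verts.Finite
  connected : P.coe.Connected
  degree_eq : ∀ v ∈ P.verts, (P.neighborSet v).encard = 2
  isInduced : P.IsInduced

/-- The set of all lengths (numbers of edges) of snake paths in `G`. -/
def snakePathLengths {V : Type*} (G : SimpleGraph V) : Set ℕ :=
  {l | ∃ P : G.Subgraph, IsSnakePath P ∧ P.edgeSet.ncard = l}

/-- The set of all lengths (numbers of edges) of snake cycles in `G`. -/
def snakeCycleLengths {V : Type*} (G : SimpleGraph V) : Set ℕ :=
  {l | ∃ P : G.Subgraph, IsSnakeCycle P ∧ P.edgeSet.ncard = l}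

/-- The knight graph on a set `S` of cells, a cell being a pair of integers. -/
def knightGraph (S : Set (ℤ × ℤ)) : SimpleGraph S where
  Adj a b :=
    (|a.1.1 - b.1.1| = 1 ∧ |a.1.2 - b.1.2| = 2) ∨ (|a.1.1 - b.1.1| = 2 ∧ |a.1.2 - b.1.2| = 1)
  symm := ⟨fun a b h => by
    rw [abs_sub_comm b.1.1 a.1.1, abs_sub_comm b.1.2 a.1.2]
    exact h⟩
  loopless := ⟨fun a h => by simp at h⟩

/-- The standard board with `m` rows and `n` columns. -/
def board (m n : ℕ) : Set (ℤ × ℤ) :=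
  Set.Ico 0 (n : ℤ) ×ˢ Set.Ico 0 (m : ℤ)

end Snake

/-! Upper bound. The subset sums of the moves (1,2), (1,-2), (2,1), (2,-1) are sixteen distinct
cells, and flipping one summand is a knight move, so every translate of these cells carries a copy
of the hypercube Q4. A finite search shows that a vertex set of Q4 with induced degrees at most two
has at most 8 elements, unless its vertices with two neighbours form a nonempty union of cycles. In
a snake such cycles leave no neighbour outside, so by connectedness they are the whole snake, which
then has at most 16 cells. Hence a larger snake fills at most half of every translate
(`card_cube_le`), and averaging over the translates that meet the board gives `two_mul_card_le`.

Lower bound. A strip of width two splits into four disjoint knight paths running along it, since a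
knight inside it must move two cells forward and change lane. Strips two cells apart do not
interfere, which gives density 1/2. On each of the four sides of a rectangle, k nested strips are
laid; at its ends every strip has its four strands joined into one path, the strips of a side are
chained, and the sides are closed into one cycle by two sparse wires and two crossings near the
centre. The pattern consists of 4 × 4 tiles. Induced degree two is a local property, so it is
verified on one small spiral and transferred (`knightDegree_spiral`); connectedness is proved by
following the path (`knightConnected_spiral`). Only O(m + n) tiles are not straight, whence
`le_card_spiral`.

A snake path of almost the same length arises by deleting a vertex of a long cycle. Small or thin
boards are absorbed by the error term. With only two rows, the rightmost cell of any set has at most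
one neighbour, so no cycle exists. -/

namespace Snake

/-! ### Induced subgraphs of maximum degree two in the four-dimensional hypercube -/

/-- The bitmask of the first `n` values of `t`. -/
def bitPrefix (t : ℕ → Bool) : ℕ → ℕ
  | 0 => 0
  | n + 1 => bitPrefix t n + if t n then 2 ^ n else 0

/-- The number of bits of `m` at the hypercube neighbours of the index `i < 16`. -/
def cubeDegree (m i : ℕ) : ℕ :=
  (m.testBit (i ^^^ 1)).toNat + (m.testBit (i ^^^ 2)).toNat +
    (m.testBit (i ^^^ 4)).toNat + (m.testBit (i ^^^ 8)).toNat

/-- The vertices of `m` with at least two neighbours in `m`. -/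
def cubePrune (m : ℕ) : ℕ :=
  bitPrefix (fun i => m.testBit i && Nat.ble 2 (cubeDegree m i)) 16

/-- Some index at or next to `i` is in `m` and has at least three neighbours in `m`. -/
def cubeCrowded (m i : ℕ) : Bool :=
  [i, i ^^^ 1, i ^^^ 2, i ^^^ 4, i ^^^ 8].any fun j => m.testBit j && Nat.ble 3 (cubeDegree m j)

/-- The vertices of `m` with at least two neighbours in `m` form a nonempty set of minimum degree
at least two. -/
def cubeHasCore (m : ℕ) : Bool :=
  Nat.blt 0 (cubePrune m) && Nat.beq (cubePrune (cubePrune m)) (cubePrune m)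

/-- Depth-first search over the extensions of the vertex set `m` with `c` elements by vertices
with index at least `16 - n`: each one has at most eight elements, is crowded or has a core. -/
def cubeSearch : ℕ → ℕ → ℕ → Bool
  | 0, m, c => Nat.ble c 8 || cubeHasCore m
  | n + 1, m, c => Nat.ble (c + (n + 1)) 8 || (cubeSearch n m c &&
      (cubeCrowded (m + 2 ^ (15 - n)) (15 - n) || cubeSearch n (m + 2 ^ (15 - n)) (c + 1)))

theorem cubeSearch_eq_true : cubeSearch 16 0 0 = true := by decide +kernel

theorem bitPrefix_lt (t : ℕ → Bool) (n : ℕ) : bitPrefix t n < 2 ^ n := by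
  induction n with
  | zero => simp [bitPrefix]
  | succ n ih => rw [bitPrefix, pow_succ]; split_ifs <;> omega

theorem testBit_bitPrefix (t : ℕ → Bool) (n j : ℕ) :
    (bitPrefix t n).testBit j = (decide (j < n) && t j) := by
  induction n with
  | zero => simp [bitPrefix]
  | succ n ih =>
    have hlt := bitPrefix_lt t n
    rw [bitPrefix]
    rcases lt_trichotomy j n with h | rfl | h
    · have h1 : j < n + 1 := by omega
      split_ifs
      · rw [add_comm, Nat.testBit_two_pow_add_gt h, ih]; simp [h, h1]
      · rw [add_zero, ih]; simp [h, h1]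
    · split_ifs with ht
      · rw [add_comm, Nat.testBit_two_pow_add_eq, Nat.testBit_lt_two_pow hlt]; simp [ht]
      · rw [add_zero, Nat.testBit_lt_two_pow hlt]; simp [ht]
    · have h1 : ¬ j < n + 1 := by omega
      rw [Nat.testBit_lt_two_pow]
      · simp [h1]
      · have h2 : 2 ^ (n + 1) ≤ 2 ^ j := Nat.pow_le_pow_right (by norm_num) h
        have := bitPrefix_lt t (n + 1)
        rw [bitPrefix] at this
        omega

theorem card_filter_or_hasCore (t : ℕ → Bool)
    (ht : ∀ j, t j → (t (j ^^^ 1)).toNat + (t (j ^^^ 2)).toNat + (t (j ^^^ 4)).toNat +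
      (t (j ^^^ 8)).toNat ≤ 2) :
    ((Finset.range 16).filter fun i => t i).card ≤ 8 ∨ cubeHasCore (bitPrefix t 16) := by
  have hle : ∀ n j, (bitPrefix t n).testBit j ≤ t j := fun n j => by
    rw [testBit_bitPrefix]; cases t j <;> simp
  -- Passing to a prefix only lowers degrees, so the crowded branches of the search are never taken
  -- by `t`.
  have hcrowd : ∀ n i, cubeCrowded (bitPrefix t n) i = false := by
    intro n i
    rw [cubeCrowded, List.any_eq_false]
    intro j _
    by_contra h
    simp only [Bool.and_eq_true, Nat.ble_eq] at h
    have hj : t j := by have := hle n j; rw [h.1] at this; exact Bool.le_iff_imp.1 this rfl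
    have h1 := ht j hj
    have h2 := h.2
    unfold cubeDegree at h2
    have h3 := fun b => Bool.toNat_le_toNat (hle n (j ^^^ b))
    have := h3 1; have := h3 2; have := h3 4; have := h3 8
    omega
  -- Follow the branch of the search that agrees with `t`: with `n` indices left to decide, the
  -- state is the prefix of length `16 - n`.
  have key : ∀ n, n ≤ 16 →
      cubeSearch n (bitPrefix t (16 - n)) ((Finset.range (16 - n)).filter fun i => t i).card →
      ((Finset.range 16).filter fun i => t i).card ≤ 8 ∨ cubeHasCore (bitPrefix t 16) := by
    intro n
    induction n with
    | zero =>
      intro _ h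
      simpa [cubeSearch] using h
    | succ n ih =>
      intro hn h
      have e : 16 - n = 16 - (n + 1) + 1 := by omega
      have e' : 15 - n = 16 - (n + 1) := by omega
      rw [cubeSearch, e'] at h
      simp only [Bool.or_eq_true, Bool.and_eq_true, Nat.ble_eq] at h
      rcases h with h | ⟨h1, h2⟩
      · left
        have hsub : ((Finset.range 16).filter fun i => t i) ⊆
            ((Finset.range (16 - (n + 1))).filter fun i => t i) ∪
              Finset.Ico (16 - (n + 1)) 16 := by
          intro i hi
          simp only [Finset.mem_filter, Finset.mem_range, Finset.mem_union, Finset.mem_Ico] at hi ⊢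
          by_cases hc : i < 16 - (n + 1)
          · exact Or.inl ⟨hc, hi.2⟩
          · exact Or.inr ⟨by omega, hi.1⟩
        have h3 := (Finset.card_le_card hsub).trans (Finset.card_union_le _ _)
        rw [Nat.card_Ico] at h3
        omega
      · apply ih (by omega)
        rw [e, bitPrefix, Finset.range_add_one, Finset.filter_insert]
        split_ifs with hb
        · rw [Finset.card_insert_of_notMem (by simp)]
          rcases h2 with h2 | h2
          · have := hcrowd (16 - (n + 1) + 1) (16 - (n + 1))
            rw [bitPrefix, if_pos hb, h2] at this
            cases this
          · exact h2
        · exact h1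
  exact key 16 le_rfl cubeSearch_eq_true

/-! ### The knight relation -/

/-- Two cells are a knight move apart. -/
def KnightAdj (p q : ℤ × ℤ) : Prop :=
  (|p.1 - q.1| = 1 ∧ |p.2 - q.2| = 2) ∨ (|p.1 - q.1| = 2 ∧ |p.2 - q.2| = 1)

instance : DecidableRel KnightAdj := fun p q => by unfold KnightAdj; infer_instance

theorem KnightAdj.symm {p q : ℤ × ℤ} (h : KnightAdj p q) : KnightAdj q p := by
  unfold KnightAdj at *
  rwa [abs_sub_comm q.1, abs_sub_comm q.2]

theorem knightAdj_add_left (p q r : ℤ × ℤ) : KnightAdj (p + q) (p + r) ↔ KnightAdj q r := by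
  simp [KnightAdj]

/-- A finite set of cells no nonempty proper subset of which is closed under knight moves. -/
def KnightConnected (S : Finset (ℤ × ℤ)) : Prop :=
  ∀ U ⊆ S, U.Nonempty → (∀ u ∈ U, ∀ v ∈ S, KnightAdj u v → v ∈ U) → U = S

/-- The subset sums of the four moves to the right. -/
def cubeCell (i : ℕ) : ℤ × ℤ :=
  (if i.testBit 0 then (1, 2) else 0) + (if i.testBit 1 then (1, -2) else 0) +
    (if i.testBit 2 then (2, 1) else 0) + (if i.testBit 3 then (2, -1) else 0)

theorem cubeCell_injOn : Set.InjOn cubeCell {i | i < 16} := by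
  have : ∀ i < 16, ∀ j < 16, cubeCell i = cubeCell j → i = j := by decide +kernel
  exact fun i hi j hj h => this i hi j hj h

theorem knightAdj_cubeCell :
    ∀ i < 16, ∀ b ∈ ({1, 2, 4, 8} : Finset ℕ), i ^^^ b < 16 ∧
      KnightAdj (cubeCell i) (cubeCell (i ^^^ b)) := by
  decide +kernel

theorem cubeCell_mem_box : ∀ i < 16, (0 ≤ (cubeCell i).1 ∧ (cubeCell i).1 ≤ 6) ∧
    (-3 ≤ (cubeCell i).2 ∧ (cubeCell i).2 ≤ 3) := by
  decide +kernel

theorem sum_toNat_eq_card_filter (t : ℕ → Bool) (j : ℕ) :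
    (t (j ^^^ 1)).toNat + (t (j ^^^ 2)).toNat + (t (j ^^^ 4)).toNat + (t (j ^^^ 8)).toNat =
      (({1, 2, 4, 8} : Finset ℕ).filter fun b => t (j ^^^ b)).card := by
  simp only [Finset.card_filter, Bool.toNat]
  rw [Finset.sum_insert (by decide), Finset.sum_insert (by decide), Finset.sum_insert (by decide),
    Finset.sum_singleton]
  cases t (j ^^^ 1) <;> cases t (j ^^^ 2) <;> cases t (j ^^^ 4) <;> cases t (j ^^^ 8) <;> rfl

theorem xor_right_injective (j : ℕ) : Function.Injective fun b => j ^^^ b :=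
  fun _ _ h => Nat.xor_right_injective h

/-- The neighbours of a hypercube vertex that satisfy `t` map injectively to the knight
neighbours of its cell. -/
theorem exists_image_neighbors {S : Finset (ℤ × ℤ)} (p : ℤ × ℤ) (t : ℕ → Bool)
    (ht : ∀ i < 16, t i → p + cubeCell i ∈ S) {j : ℕ} (hj : j < 16) :
    ∃ A ⊆ S.filter (KnightAdj (p + cubeCell j)),
      A.card = (t (j ^^^ 1)).toNat + (t (j ^^^ 2)).toNat + (t (j ^^^ 4)).toNat +
        (t (j ^^^ 8)).toNat ∧ ∀ v ∈ A, ∃ i < 16, t i ∧ v = p + cubeCell i := by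
  refine ⟨(({1, 2, 4, 8} : Finset ℕ).filter fun b => t (j ^^^ b)).image
    fun b => p + cubeCell (j ^^^ b), ?_, ?_, ?_⟩
  · intro v hv
    obtain ⟨b, hb, rfl⟩ := Finset.mem_image.1 hv
    obtain ⟨hb, htb⟩ := Finset.mem_filter.1 hb
    obtain ⟨h1, h2⟩ := knightAdj_cubeCell j hj b hb
    exact Finset.mem_filter.2 ⟨ht _ h1 htb, (knightAdj_add_left _ _ _).2 h2⟩
  · rw [Finset.card_image_of_injOn, sum_toNat_eq_card_filter]
    intro b hb c hc h
    exact xor_right_injective j (cubeCell_injOn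
      (knightAdj_cubeCell j hj b (Finset.mem_filter.1 hb).1).1
      (knightAdj_cubeCell j hj c (Finset.mem_filter.1 hc).1).1 (add_left_cancel h))
  · intro v hv
    obtain ⟨b, hb, rfl⟩ := Finset.mem_image.1 hv
    obtain ⟨hb, htb⟩ := Finset.mem_filter.1 hb
    exact ⟨_, (knightAdj_cubeCell j hj b hb).1, htb, rfl⟩

/-- If the translate held more than 8 cells, its core would be closed under moves within `S`, hence
equal to `S`, contradicting `16 < S.card`. -/
theorem card_cube_le {S : Finset (ℤ × ℤ)} (hdeg : ∀ v ∈ S, (S.filter (KnightAdj v)).card ≤ 2)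
    (hconn : KnightConnected S) (hcard : 16 < S.card) (p : ℤ × ℤ) :
    ((Finset.range 16).filter fun i => p + cubeCell i ∈ S).card ≤ 8 := by
  -- The condition `i < 16` makes the degree hypothesis vacuous for indices outside the cube.
  set t : ℕ → Bool := fun i => decide (i < 16 ∧ p + cubeCell i ∈ S) with ht
  have htS : ∀ i < 16, t i → p + cubeCell i ∈ S := fun i _ h => (of_decide_eq_true h).2
  have hd : ∀ j, t j → (t (j ^^^ 1)).toNat + (t (j ^^^ 2)).toNat + (t (j ^^^ 4)).toNat +
      (t (j ^^^ 8)).toNat ≤ 2 := by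
    intro j hj
    have hj' := of_decide_eq_true hj
    obtain ⟨A, hA, hcA, -⟩ := exists_image_neighbors p t htS hj'.1
    rw [← hcA]
    exact (Finset.card_le_card hA).trans (hdeg _ hj'.2)
  rcases card_filter_or_hasCore t hd with h | h
  · refine le_trans (le_of_eq ?_) h
    congr 1
    ext i
    simp only [Finset.mem_filter, Finset.mem_range, ht, decide_eq_true_eq]
    tauto
  · exfalso
    set c := cubePrune (bitPrefix t 16) with hc
    simp only [cubeHasCore, Bool.and_eq_true, ← hc] at h
    obtain ⟨hpos, hcore⟩ := h
    have hct : ∀ i, c.testBit i → i < 16 ∧ t i := by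
      intro i hi
      rw [hc, cubePrune, testBit_bitPrefix, testBit_bitPrefix] at hi
      simp only [Bool.and_eq_true, decide_eq_true_eq] at hi
      exact ⟨hi.1, hi.2.1.2⟩
    have hc2 : ∀ i, c.testBit i → 2 ≤ cubeDegree c i := by
      intro i hi
      rw [← Nat.eq_of_beq_eq_true hcore, cubePrune, testBit_bitPrefix] at hi
      simp only [Bool.and_eq_true, decide_eq_true_eq, Nat.ble_eq] at hi
      exact hi.2.2
    set U := ((Finset.range 16).filter fun i => c.testBit i).image fun i => p + cubeCell i with hU
    have hUS : U ⊆ S := by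
      intro v hv
      obtain ⟨i, hi, rfl⟩ := Finset.mem_image.1 hv
      obtain ⟨h1, h2⟩ := hct i (Finset.mem_filter.1 hi).2
      exact htS i h1 h2
    have hUcard : U.card ≤ 16 :=
      Finset.card_image_le.trans ((Finset.card_filter_le _ _).trans (by simp))
    have hne : U.Nonempty := by
      obtain ⟨i, hi⟩ := Nat.exists_testBit_of_ne_zero (x := c) (by
        have : 0 < c := by simpa [Nat.blt_eq] using hpos
        omega)
      exact ⟨_, Finset.mem_image_of_mem _
        (Finset.mem_filter.2 ⟨Finset.mem_range.2 (hct i hi).1, hi⟩)⟩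
    have := hconn U hUS hne (by
      intro u hu v hv huv
      obtain ⟨i, hi, rfl⟩ := Finset.mem_image.1 hu
      obtain ⟨hi16, hic⟩ := Finset.mem_filter.1 hi
      obtain ⟨A, hA, hcA, hAU⟩ := exists_image_neighbors (S := S) p (fun i => c.testBit i)
        (fun i h16 h => htS i h16 (hct i h).2) (Finset.mem_range.1 hi16)
      -- The core vertex already has two neighbours inside the core, so `v` would be a third.
      by_contra hvU
      have hvA : v ∉ A := by
        intro hv'
        obtain ⟨j, hj, hjc, rfl⟩ := hAU v hv'
        exact hvU (Finset.mem_image_of_mem _ (Finset.mem_filter.2 ⟨Finset.mem_range.2 hj, hjc⟩))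
      have h3 : (insert v A).card ≤ 2 :=
        (Finset.card_le_card (Finset.insert_subset (Finset.mem_filter.2 ⟨hv, huv⟩) hA)).trans
          (hdeg _ (hUS hu))
      rw [Finset.card_insert_of_notMem hvA, hcA] at h3
      have h4 := hc2 i hic
      unfold cubeDegree at h4
      omega)
    rw [this] at hUcard
    omega

/-- A connected set of cells of the board with induced degrees at most two covers at most about
half of the board. -/
theorem two_mul_card_le {S : Finset (ℤ × ℤ)} (hdeg : ∀ v ∈ S, (S.filter (KnightAdj v)).card ≤ 2)
    (hconn : KnightConnected S) {m n : ℕ} (hS : ∀ v ∈ S, v ∈ board m n) :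
    2 * S.card ≤ (n + 6) * (m + 6) := by
  by_cases hcard : S.card ≤ 16
  · nlinarith
  push Not at hcard
  -- All base points whose translate can meet the board, the cube lying in `[0, 6] × [-3, 3]`. Each
  -- cell of `S` is then covered exactly sixteen times.
  set B : Finset (ℤ × ℤ) := Finset.Ico (-6) (n : ℤ) ×ˢ Finset.Ico (-3) ((m : ℤ) + 3) with hB
  have hBcard : B.card = (n + 6) * (m + 6) := by
    rw [hB, Finset.card_product, Int.card_Ico, Int.card_Ico]
    congr 1
  have h1 : ∀ i ∈ Finset.range 16, (B.filter fun p => p + cubeCell i ∈ S).card = S.card := by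
    intro i hi
    refine Finset.card_bij (fun p _ => p + cubeCell i) (fun p hp => (Finset.mem_filter.1 hp).2)
      (fun p _ q _ h => add_right_cancel h) fun v hv => ⟨v - cubeCell i, ?_, by simp⟩
    have hb := cubeCell_mem_box i (Finset.mem_range.1 hi)
    have hv' := hS v hv
    simp only [board, Set.mem_prod, Set.mem_Ico] at hv'
    simp only [hB, Finset.mem_filter, Finset.mem_product, Finset.mem_Ico, sub_add_cancel, hv,
      and_true, Prod.fst_sub, Prod.snd_sub]
    omega
  have h2 : 16 * S.card = ∑ p ∈ B, ((Finset.range 16).filter fun i => p + cubeCell i ∈ S).card := by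
    calc 16 * S.card = ∑ i ∈ Finset.range 16, (B.filter fun p => p + cubeCell i ∈ S).card := by
          rw [Finset.sum_congr rfl h1]; simp
      _ = _ := by
          simp only [Finset.card_filter]
          exact Finset.sum_comm
  have h3 : 16 * S.card ≤ B.card * 8 := by
    rw [h2]
    exact Finset.sum_le_card_nsmul _ _ _ fun p _ => card_cube_le hdeg hconn hcard p
  rw [hBcard] at h3
  omega

/-! ### Snakes as finite sets of cells -/

/-- The number of cells of `S` a knight move away from `v`. -/
def knightDegree (S : Finset (ℤ × ℤ)) (v : ℤ × ℤ) : ℕ := (S.filter (KnightAdj v)).card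

theorem knightGraph_adj {B : Set (ℤ × ℤ)} {a b : B} :
    (knightGraph B).Adj a b ↔ KnightAdj a.1 b.1 := Iff.rfl

/-- Stated for a graph on any type mapped onto the cells, so that it also serves knight graphs with
a vertex deleted, where vertices are nested subtypes. -/
theorem knightConnected_of_connected {V : Type*} {G : SimpleGraph V} (hG : G.Connected)
    {T : Finset (ℤ × ℤ)} (f : V → ℤ × ℤ) (hf : ∀ p, p ∈ T ↔ ∃ a, f a = p)
    (hadj : ∀ a b, G.Adj a b → KnightAdj (f a) (f b)) : KnightConnected T := by
  intro U hU hne hclosed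
  obtain ⟨u, hu⟩ := hne
  obtain ⟨a, rfl⟩ := (hf u).1 (hU hu)
  refine Finset.Subset.antisymm hU fun p hp => ?_
  obtain ⟨b, rfl⟩ := (hf p).1 hp
  have hr := (SimpleGraph.reachable_iff_reflTransGen a b).1 (hG.preconnected a b)
  clear hp
  induction hr with
  | refl => exact hu
  | tail _ h ih => exact hclosed _ ih _ ((hf _).2 ⟨_, rfl⟩) (hadj _ _ h)

theorem KnightConnected.connected {S : Finset (ℤ × ℤ)} (hS : KnightConnected S)
    (hne : S.Nonempty) : (knightGraph (S : Set (ℤ × ℤ))).Connected := by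
  classical
  obtain ⟨b, hb⟩ := hne
  set G := knightGraph (S : Set (ℤ × ℤ))
  have key : S.filter (fun p => ∃ h : p ∈ S, G.Reachable ⟨b, hb⟩ ⟨p, h⟩) = S := by
    refine hS _ (Finset.filter_subset _ _) ⟨b, Finset.mem_filter.2 ⟨hb, hb, .rfl⟩⟩ ?_
    intro u hu v hv huv
    obtain ⟨-, hu, hr⟩ := Finset.mem_filter.1 hu
    refine Finset.mem_filter.2 ⟨hv, hv, hr.trans (SimpleGraph.Adj.reachable ?_)⟩
    exact knightGraph_adj.2 huv
  have hr : ∀ p : (S : Set (ℤ × ℤ)), G.Reachable ⟨b, hb⟩ p := by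
    rintro ⟨p, hp⟩
    have hp' := hp
    rw [Finset.mem_coe, ← key] at hp'
    exact (Finset.mem_filter.1 hp').2.2
  have : Nonempty (S : Set (ℤ × ℤ)) := ⟨⟨b, hb⟩⟩
  exact ⟨fun p q => (hr p).symm.trans (hr q)⟩

theorem two_mul_card_edgeSet (S : Finset (ℤ × ℤ)) :
    2 * Nat.card (knightGraph (S : Set (ℤ × ℤ))).edgeSet = ∑ v ∈ S, knightDegree S v := by
  classical
  have h := (knightGraph (S : Set (ℤ × ℤ))).sum_degrees_eq_twice_card_edges
  rw [Nat.card_eq_fintype_card, ← SimpleGraph.edgeFinset_card, ← h, ← Finset.sum_coe_sort S]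
  refine Finset.sum_congr rfl fun v _ => ?_
  rw [← SimpleGraph.card_neighborFinset_eq_degree, knightDegree]
  refine Finset.card_bij (fun w _ => w.1) (fun w hw => ?_) (fun _ _ _ _ h => Subtype.ext h)
    fun w hw => ?_
  · rw [SimpleGraph.mem_neighborFinset] at hw
    exact Finset.mem_filter.2 ⟨w.2, hw⟩
  · obtain ⟨h1, h2⟩ := Finset.mem_filter.1 hw
    exact ⟨⟨w, h1⟩, (SimpleGraph.mem_neighborFinset _ _ _).2 h2, rfl⟩

section Subgraph

variable {B : Set (ℤ × ℤ)} {P : (knightGraph B).Subgraph} {S : Finset (ℤ × ℤ)}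

/-- An induced subgraph of a knight graph is the knight graph on its set of cells. -/
def isoOfInduced (hP : P.IsInduced) (hS : ∀ p, p ∈ S ↔ ∃ h : p ∈ B, ⟨p, h⟩ ∈ P.verts) :
    P.coe ≃g knightGraph (S : Set (ℤ × ℤ)) where
  toFun v := ⟨v.1.1, (hS _).2 ⟨v.1.2, v.2⟩⟩
  invFun p := ⟨⟨p.1, ((hS _).1 p.2).1⟩, ((hS _).1 p.2).2⟩
  left_inv _ := rfl
  right_inv _ := rfl
  map_rel_iff' {a b} := ⟨fun h => hP a.2 b.2 h, fun h => P.adj_sub h⟩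

theorem encard_neighborSet_of_induced (hP : P.IsInduced)
    (hS : ∀ p, p ∈ S ↔ ∃ h : p ∈ B, ⟨p, h⟩ ∈ P.verts) {v : B} (hv : v ∈ P.verts) :
    (P.neighborSet v).encard = knightDegree S v.1 := by
  rw [← Subtype.val_injective.encard_image, knightDegree, ← Set.encard_coe_eq_coe_finsetCard]
  congr 1
  ext p
  simp only [Set.mem_image, SimpleGraph.Subgraph.mem_neighborSet, Finset.coe_filter,
    Set.mem_ofPred_eq]
  constructor
  · rintro ⟨w, hw, rfl⟩
    exact ⟨(hS _).2 ⟨w.2, P.edge_vert hw.symm⟩, P.adj_sub hw⟩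
  · rintro ⟨hp, hadj⟩
    obtain ⟨hB, hp⟩ := (hS p).1 hp
    exact ⟨⟨p, hB⟩, hP hv hp hadj, rfl⟩

theorem ncard_edgeSet_of_induced (hP : P.IsInduced)
    (hS : ∀ p, p ∈ S ↔ ∃ h : p ∈ B, ⟨p, h⟩ ∈ P.verts) :
    P.edgeSet.ncard = Nat.card (knightGraph (S : Set (ℤ × ℤ))).edgeSet := by
  rw [← P.image_coe_edgeSet_coe,
    Set.ncard_image_of_injective _ (Sym2.map.injective Subtype.val_injective),
    ← Nat.card_coe_set_eq]
  exact Nat.card_congr (isoOfInduced hP hS).mapEdgeSet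

theorem exists_finset_of_finite (hP : P.verts.Finite) :
    ∃ S : Finset (ℤ × ℤ), ∀ p, p ∈ S ↔ ∃ h : p ∈ B, ⟨p, h⟩ ∈ P.verts := by
  classical
  exact ⟨hP.toFinset.image Subtype.val, by simp⟩

theorem exists_induced_of_subset (hB : ∀ p ∈ S, p ∈ B) :
    ∃ P : (knightGraph B).Subgraph, P.IsInduced ∧ P.verts.Finite ∧
      ∀ p, p ∈ S ↔ ∃ h : p ∈ B, ⟨p, h⟩ ∈ P.verts := by
  refine ⟨(⊤ : (knightGraph B).Subgraph).induce {v | v.1 ∈ S}, ?_, ?_, ?_⟩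
  · intro v hv w hw h
    exact ⟨hv, hw, h⟩
  · exact Set.Finite.preimage Subtype.val_injective.injOn S.finite_toSet
  · exact fun p => ⟨fun hp => ⟨hB p hp, hp⟩, fun ⟨_, hp⟩ => hp⟩

end Subgraph

theorem card_coe_finset (S : Finset (ℤ × ℤ)) : Nat.card (S : Set (ℤ × ℤ)) = S.card := by
  simp

/-- When all degrees are two, the handshake formula makes the number of edges equal to the number of
cells. -/
theorem mem_snakeCycleLengths {B : Set (ℤ × ℤ)} {l : ℕ} :
    l ∈ snakeCycleLengths (knightGraph B) ↔ ∃ S : Finset (ℤ × ℤ), (∀ p ∈ S, p ∈ B) ∧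
      S.Nonempty ∧ KnightConnected S ∧ (∀ v ∈ S, knightDegree S v = 2) ∧ S.card = l := by
  constructor
  · rintro ⟨P, hP, rfl⟩
    obtain ⟨S, hS⟩ := exists_finset_of_finite hP.finite
    have e := isoOfInduced hP.isInduced hS
    have hconn := e.connected_iff.1 hP.connected
    have hdeg : ∀ v ∈ S, knightDegree S v = 2 := by
      intro v hv
      obtain ⟨hB, hv⟩ := (hS v).1 hv
      have := hP.degree_eq _ hv
      rw [encard_neighborSet_of_induced hP.isInduced hS hv] at this
      exact_mod_cast this
    refine ⟨S, fun p hp => ((hS p).1 hp).1, ?_, ?_, hdeg, ?_⟩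
    · obtain ⟨v⟩ := hconn.nonempty
      exact ⟨v.1, v.2⟩
    · exact knightConnected_of_connected hconn (fun v => v.1) (by simp) fun _ _ h => h
    · have := two_mul_card_edgeSet S
      rw [Finset.sum_congr rfl hdeg, Finset.sum_const, ← ncard_edgeSet_of_induced hP.isInduced hS,
        smul_eq_mul] at this
      omega
  · rintro ⟨S, hB, hne, hconn, hdeg, rfl⟩
    obtain ⟨P, hP, hfin, hS⟩ := exists_induced_of_subset hB
    have e := isoOfInduced hP hS
    refine ⟨P, ⟨hfin, e.connected_iff.2 (hconn.connected hne), ?_, hP⟩, ?_⟩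
    · intro v hv
      rw [encard_neighborSet_of_induced hP hS hv, hdeg _ ((hS _).2 ⟨v.2, hv⟩)]
      rfl
    · have := two_mul_card_edgeSet S
      rw [Finset.sum_congr rfl hdeg, Finset.sum_const, ← ncard_edgeSet_of_induced hP hS,
        smul_eq_mul] at this
      omega

theorem exists_of_mem_snakePathLengths {B : Set (ℤ × ℤ)} {l : ℕ}
    (hl : l ∈ snakePathLengths (knightGraph B)) : ∃ S : Finset (ℤ × ℤ), (∀ p ∈ S, p ∈ B) ∧
      KnightConnected S ∧ (∀ v ∈ S, knightDegree S v ≤ 2) ∧ S.card = l + 1 := by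
  obtain ⟨P, hP, rfl⟩ := hl
  obtain ⟨S, hS⟩ := exists_finset_of_finite hP.finite
  have e := isoOfInduced hP.isInduced hS
  have htree := e.isTree_iff.1 hP.isTree
  refine ⟨S, fun p hp => ((hS p).1 hp).1, ?_, ?_, ?_⟩
  · exact knightConnected_of_connected htree.connected (fun v => v.1) (by simp) fun _ _ h => h
  · intro v hv
    obtain ⟨hB, hv⟩ := (hS v).1 hv
    have := hP.degree_le _ hv
    rw [encard_neighborSet_of_induced hP.isInduced hS hv] at this
    exact_mod_cast this
  · have := (SimpleGraph.isTree_iff_connected_and_card.1 htree).2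
    rw [card_coe_finset, ← ncard_edgeSet_of_induced hP.isInduced hS] at this
    exact this.symm

/-- The degree sum gives one edge fewer than vertices, and a connected graph with that many edges is
a tree. -/
theorem mem_snakePathLengths_of_sum {B : Set (ℤ × ℤ)} {S : Finset (ℤ × ℤ)}
    (hB : ∀ p ∈ S, p ∈ B) (hconn : (knightGraph (S : Set (ℤ × ℤ))).Connected)
    (hdeg : ∀ v ∈ S, knightDegree S v ≤ 2)
    {l : ℕ} (hl : S.card = l + 1) (hsum : ∑ v ∈ S, knightDegree S v = 2 * l) :
    l ∈ snakePathLengths (knightGraph B) := by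
  obtain ⟨P, hP, hfin, hS⟩ := exists_induced_of_subset hB
  have e := isoOfInduced hP hS
  have hedge : Nat.card (knightGraph (S : Set (ℤ × ℤ))).edgeSet = l := by
    have := two_mul_card_edgeSet S
    omega
  refine ⟨P, ⟨hfin, e.isTree_iff.2 ?_, ?_, hP⟩, ?_⟩
  · exact SimpleGraph.isTree_iff_connected_and_card.2 ⟨hconn, by rw [hedge, card_coe_finset, hl]⟩
  · intro v hv
    rw [encard_neighborSet_of_induced hP hS hv]
    exact_mod_cast hdeg _ ((hS _).2 ⟨v.2, hv⟩)
  · rw [ncard_edgeSet_of_induced hP hS, hedge]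

theorem zero_mem_snakePathLengths {B : Set (ℤ × ℤ)} {p : ℤ × ℤ} (hp : p ∈ B) :
    0 ∈ snakePathLengths (knightGraph B) := by
  have h0 : knightDegree {p} p = 0 := by simp [knightDegree, Finset.filter_singleton, KnightAdj]
  refine mem_snakePathLengths_of_sum (S := {p}) (by simpa using hp) ?_ (by simp [h0]) (by simp)
    (by simp [h0])
  have : Subsingleton (({p} : Finset (ℤ × ℤ)) : Set (ℤ × ℤ)) := by simp
  have : Nonempty (({p} : Finset (ℤ × ℤ)) : Set (ℤ × ℤ)) := ⟨⟨p, by simp⟩⟩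
  exact ⟨fun a b => by rw [Subsingleton.elim a b]⟩

/-- Deleting a vertex that does not disconnect a snake cycle gives a snake path. -/
theorem sub_two_mem_snakePathLengths {B : Set (ℤ × ℤ)} {l : ℕ}
    (hl : l ∈ snakeCycleLengths (knightGraph B)) :
    l - 2 ∈ snakePathLengths (knightGraph B) := by
  obtain ⟨S, hB, hne, hconn, hdeg, rfl⟩ := mem_snakeCycleLengths.1 hl
  -- A cell and its two neighbours: this keeps the natural subtraction `S.card - 2` from truncating.
  have hlt : 2 < S.card := by
    obtain ⟨v, hv⟩ := hne
    have hsub : S.filter (KnightAdj v) ⊆ S.erase v := fun w hw => by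
      obtain ⟨h1, h2⟩ := Finset.mem_filter.1 hw
      refine Finset.mem_erase.2 ⟨?_, h1⟩
      rintro rfl
      simp [KnightAdj] at h2
    have h1 := Finset.card_le_card hsub
    rw [Finset.card_erase_of_mem hv] at h1
    have h2 : (S.filter (KnightAdj v)).card = 2 := hdeg v hv
    omega
  have : Nontrivial (S : Set (ℤ × ℤ)) := by
    rw [← Finite.one_lt_card_iff_nontrivial, card_coe_finset]
    omega
  obtain ⟨⟨v, hv⟩, hcut⟩ :=
    (hconn.connected hne).exists_connected_induce_compl_singleton_of_finite_nontrivial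
  have hv : v ∈ S := hv
  have hadd : ∀ u ∈ S.erase v,
      knightDegree (S.erase v) u + (if KnightAdj v u then 1 else 0) = 2 := by
    intro u hu
    rw [← hdeg u (Finset.mem_of_mem_erase hu), knightDegree, knightDegree, Finset.filter_erase]
    split_ifs with h
    · exact Finset.card_erase_add_one (Finset.mem_filter.2 ⟨hv, h.symm⟩)
    · rw [Finset.erase_eq_of_notMem, add_zero]
      exact fun h' => h (Finset.mem_filter.1 h').2.symm
  have hcard : (S.erase v).card = S.card - 2 + 1 := by
    rw [Finset.card_erase_of_mem hv]
    omega
  refine mem_snakePathLengths_of_sum (S := S.erase v)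
    (fun p hp => hB p (Finset.mem_of_mem_erase hp)) ?_
    (fun u hu => by have := hadd u hu; omega) hcard ?_
  · have : KnightConnected (S.erase v) := by
      refine knightConnected_of_connected hcut (fun w => w.1.1) ?_ fun _ _ h => h
      intro p
      simp only [Finset.mem_erase]
      exact ⟨fun ⟨h1, h2⟩ => ⟨⟨⟨p, h2⟩, fun h => h1 (congrArg Subtype.val h)⟩, rfl⟩,
        by rintro ⟨⟨⟨q, hq⟩, hqv⟩, rfl⟩; exact ⟨fun h => hqv (Subtype.ext h), hq⟩⟩
    exact this.connected (Finset.card_pos.1 (by omega))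
  -- Exactly two of the remaining cells have lost a neighbour, so their degrees sum to `2 * (S.card
  -- - 1) - 2`.
  · have h1 := Finset.sum_congr rfl hadd
    have h2 : (S.filter (KnightAdj v)).card = 2 := hdeg v hv
    have h3 : (S.erase v).filter (KnightAdj v) = S.filter (KnightAdj v) := by
      rw [Finset.filter_erase, Finset.erase_eq_of_notMem]
      simp [KnightAdj]
    rw [Finset.sum_add_distrib, Finset.sum_const, hcard, ← Finset.card_filter, h3, h2,
      smul_eq_mul] at h1
    omega

/-! ### Tiles and the square spiral -/

/-- The shapes of `4 × 4` tiles, up to rotation, of the square spiral. -/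
inductive Shape
  | empty | straight | start | turn | wire | wireStart | wireEnd | joint | hook
  deriving DecidableEq

/-- A shape together with a number of counterclockwise quarter turns. -/
abbrev Tile := Shape × Fin 4

/-- The cells of a shape, in coordinates from `0` to `3`. -/
def Shape.cells : Shape → List (ℤ × ℤ)
  | .empty => []
  | .straight => [(0, 0), (0, 1), (0, 2), (0, 3), (1, 0), (1, 1), (1, 2), (1, 3)]
  | .start => [(1, 0), (3, 1), (3, 2), (3, 3)]
  | .turn => [(1, 1), (1, 2), (3, 2), (0, 3), (1, 3), (3, 3)]
  | .wire => [(3, 0), (1, 1)]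
  | .wireStart => [(3, 0), (2, 2)]
  | .wireEnd => [(2, 3), (0, 2)]
  | .joint => [(0, 0), (3, 1), (1, 2), (2, 3)]
  | .hook => [(3, 1), (1, 2)]

/-- The counterclockwise rotation of a tile by quarter turns. -/
def turnCell : Fin 4 → ℤ × ℤ → ℤ × ℤ
  | 0, c => c
  | 1, c => (3 - c.2, c.1)
  | 2, c => (3 - c.1, 3 - c.2)
  | 3, c => (c.2, 3 - c.1)

/-- The cells of a tile, in coordinates from `0` to `3`. -/
def Tile.cells (t : Tile) : List (ℤ × ℤ) := t.1.cells.map (turnCell t.2)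

/-- The tile in column `I` and row `J` of the lower half of a square spiral with `w` columns and
`k` turns. -/
def lowerTile (w k I J : ℤ) : Tile :=
  if J < 0 ∨ I < 1 ∨ w - 2 < I then (.empty, 0)
  else if J = 0 then
    if I = 1 then (.wireStart, 0) else if I = w - 2 then (.wireEnd, 0) else (.wire, 0)
  else if I < J - 1 then (.straight, 0)
  else if I = J - 1 then (.turn, 0)
  else if J = k + 1 then
    if I = J then (.joint, 2) else if I < w - 1 - J then (.empty, 0)
    else if I = w - 1 - J then (.hook, 0) else (.straight, 2)
  else if I = J then (.start, 0)
  else if I < w - 2 - J then (.straight, 1)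
  else if I = w - 2 - J then (.turn, 1)
  else if I = w - 1 - J then (.start, 1)
  else (.straight, 2)

/-- A square spiral, symmetric under a half turn. -/
def spiralTile (w k I J : ℤ) : Tile :=
  if J ≤ k + 1 then lowerTile w k I J
  else ((lowerTile w k (w - 1 - I) (2 * k + 3 - J)).1,
    (lowerTile w k (w - 1 - I) (2 * k + 3 - J)).2 + 2)

/-- The set of cells of a pattern of tiles. -/
def TileMem (T : ℤ → ℤ → Tile) (p : ℤ × ℤ) : Prop :=
  (p.1 % 4, p.2 % 4) ∈ (T (p.1 / 4) (p.2 / 4)).cells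

instance (T : ℤ → ℤ → Tile) : DecidablePred (TileMem T) := fun _ =>
  inferInstanceAs (Decidable (_ ∈ _))

theorem tileMem_add (T : ℤ → ℤ → Tile) (I J a b : ℤ) (ha : 0 ≤ a ∧ a ≤ 3) (hb : 0 ≤ b ∧ b ≤ 3) :
    TileMem T (4 * I + a, 4 * J + b) ↔ (a, b) ∈ (T I J).cells := by
  have h1 : (4 * I + a) % 4 = a := by omega
  have h2 : (4 * J + b) % 4 = b := by omega
  have h3 : (4 * I + a) / 4 = I := by omega
  have h4 : (4 * J + b) / 4 = J := by omega
  simp only [TileMem, h1, h2, h3, h4]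

theorem cells_bounds : ∀ t : Tile, ∀ c ∈ t.cells, (0 ≤ c.1 ∧ c.1 ≤ 3) ∧ (0 ≤ c.2 ∧ c.2 ≤ 3) := by
  rintro ⟨s, r⟩
  cases s <;> fin_cases r <;> decide

/-! ### Local verification of the degrees in the spiral -/

/-- The eight moves of a knight. -/
def knightMoves : Finset (ℤ × ℤ) :=
  {(1, 2), (2, 1), (-1, 2), (-2, 1), (1, -2), (2, -1), (-1, -2), (-2, -1)}

/-- The number of knight moves from the cell `c` of a tile to cells of the tile `t` at the
displacement `e` of that tile. -/
def moveCount (c e : ℤ × ℤ) (t : Tile) : ℕ :=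
  (knightMoves.filter fun d => ((c.1 + d.1) / 4, (c.2 + d.2) / 4) = e ∧
    ((c.1 + d.1) % 4, (c.2 + d.2) % 4) ∈ t.cells).card

/-- The cells of `s` have as many neighbours in the tile `t` at the displacement `e` as at the
place `q` of the spiral with ten columns and two turns. -/
def Fits (e q : ℤ × ℤ) (s t : Tile) : Prop :=
  ∀ c ∈ s.cells, moveCount c e t = moveCount c e (spiralTile 10 2 (q.1 + e.1) (q.2 + e.2))

instance (e q : ℤ × ℤ) (s t : Tile) : Decidable (Fits e q s t) :=
  inferInstanceAs (Decidable (∀ _ ∈ _, _))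

/-- The places of the tiles in the lower half of a square spiral, each with a place that looks the
same in the spiral with ten columns and two turns. -/
inductive LowerSpec (w k I J : ℤ) : Tile → ℤ × ℤ → Prop
  | outside (h : J < 0 ∨ I < 1 ∨ w - 2 < I) : LowerSpec w k I J (.empty, 0) (0, 0)
  | wireStart (h : J = 0 ∧ I = 1 ∧ I ≤ w - 2) : LowerSpec w k I J (.wireStart, 0) (1, 0)
  | wireEnd (h : J = 0 ∧ 1 < I ∧ I = w - 2) : LowerSpec w k I J (.wireEnd, 0) (8, 0)
  | wire (h : J = 0 ∧ 1 < I ∧ I < w - 2) : LowerSpec w k I J (.wire, 0) (4, 0)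
  | west (h : 1 ≤ J ∧ 1 ≤ I ∧ I ≤ w - 2 ∧ I < J - 1) : LowerSpec w k I J (.straight, 0) (1, 3)
  | westTurn (h : 1 ≤ J ∧ 1 ≤ I ∧ I ≤ w - 2 ∧ I = J - 1) : LowerSpec w k I J (.turn, 0) (1, 2)
  | joint (h : J = k + 1 ∧ 1 ≤ J ∧ I ≤ w - 2 ∧ I = J) : LowerSpec w k I J (.joint, 2) (3, 3)
  | inside (h : J = k + 1 ∧ 1 ≤ J ∧ I ≤ w - 2 ∧ J < I ∧ I < w - 1 - J) :
      LowerSpec w k I J (.empty, 0) (0, 0)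
  | hook (h : J = k + 1 ∧ 1 ≤ J ∧ J < I ∧ I ≤ w - 2 ∧ I = w - 1 - J) :
      LowerSpec w k I J (.hook, 0) (6, 3)
  | innerEast (h : J = k + 1 ∧ 1 ≤ J ∧ J < I ∧ I ≤ w - 2 ∧ w - 1 - J < I) :
      LowerSpec w k I J (.straight, 2) (8, 3)
  | southOuterStart (h : J ≠ k + 1 ∧ J = 1 ∧ I ≤ w - 2 ∧ I = J) :
      LowerSpec w k I J (.start, 0) (1, 1)
  | southStart (h : J ≠ k + 1 ∧ 2 ≤ J ∧ I ≤ w - 2 ∧ I = J) : LowerSpec w k I J (.start, 0) (2, 2)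
  | south (h : J ≠ k + 1 ∧ 1 ≤ J ∧ J < I ∧ I ≤ w - 2 ∧ I < w - 2 - J) :
      LowerSpec w k I J (.straight, 1) (4, 1)
  | southTurn (h : J ≠ k + 1 ∧ 1 ≤ J ∧ J < I ∧ I ≤ w - 2 ∧ I = w - 2 - J) :
      LowerSpec w k I J (.turn, 1) (7, 1)
  | eastOuterStart (h : J ≠ k + 1 ∧ J = 1 ∧ J < I ∧ I ≤ w - 2 ∧ I = w - 1 - J) :
      LowerSpec w k I J (.start, 1) (8, 1)
  | eastStart (h : J ≠ k + 1 ∧ 2 ≤ J ∧ J < I ∧ I ≤ w - 2 ∧ I = w - 1 - J) :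
      LowerSpec w k I J (.start, 1) (7, 2)
  | east (h : J ≠ k + 1 ∧ 1 ≤ J ∧ J < I ∧ I ≤ w - 2 ∧ w - 1 - J < I) :
      LowerSpec w k I J (.straight, 2) (8, 3)

theorem exists_lowerSpec (w k I J : ℤ) : ∃ q, LowerSpec w k I J (lowerTile w k I J) q := by
  unfold lowerTile
  split_ifs
  · exact ⟨_, .outside (by omega)⟩
  · exact ⟨_, .wireStart (by omega)⟩
  · exact ⟨_, .wireEnd (by omega)⟩
  · exact ⟨_, .wire (by omega)⟩
  · exact ⟨_, .west (by omega)⟩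
  · exact ⟨_, .westTurn (by omega)⟩
  · exact ⟨_, .joint (by omega)⟩
  · exact ⟨_, .inside (by omega)⟩
  · exact ⟨_, .hook (by omega)⟩
  · exact ⟨_, .innerEast (by omega)⟩
  · obtain h | h : J = 1 ∨ 2 ≤ J := by omega
    · exact ⟨_, .southOuterStart (by omega)⟩
    · exact ⟨_, .southStart (by omega)⟩
  · exact ⟨_, .south (by omega)⟩
  · exact ⟨_, .southTurn (by omega)⟩
  · obtain h | h : J = 1 ∨ 2 ≤ J := by omega
    · exact ⟨_, .eastOuterStart (by omega)⟩
    · exact ⟨_, .eastStart (by omega)⟩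
  · exact ⟨_, .east (by omega)⟩

/-- The model spiral is checked directly at the finitely many model places; a move reaches only the
3 × 3 block of tiles around its origin. -/
theorem LowerSpec.sum_moveCount {w k I J : ℤ} {t : Tile} {q : ℤ × ℤ} (h : LowerSpec w k I J t q) :
    ∀ c ∈ t.cells, ∑ e ∈ Finset.Icc (-1 : ℤ) 1 ×ˢ Finset.Icc (-1 : ℤ) 1,
      moveCount c e (spiralTile 10 2 (q.1 + e.1) (q.2 + e.2)) = 2 := by
  cases h <;> decide +kernel

-- For two kinds of place at a given displacement, either the inequalities defining them are
-- incompatible, or the neighbouring tile acts on `s` as in the model. Only move counts are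
-- compared, so a neighbour may differ from the model where `s` does not see it.
set_option maxHeartbeats 8000000 in
theorem LowerSpec.fits {w k I J : ℤ} (hk : 1 ≤ k) (hw : 2 * k + 5 ≤ w) (hJ : J ≤ k + 1)
    {e : ℤ × ℤ} (he : e ∈ Finset.Icc (-1 : ℤ) 1 ×ˢ Finset.Icc (-1 : ℤ) 1) (hJ' : J + e.2 ≤ k + 1)
    {s t : Tile} {q q' : ℤ × ℤ} (hs : LowerSpec w k I J s q)
    (ht : LowerSpec w k (I + e.1) (J + e.2) t q') : Fits e q s t := by
  obtain ⟨e₁, e₂⟩ := e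
  simp only [Finset.mem_product, Finset.mem_Icc] at he
  obtain ⟨⟨h1, h2⟩, h3, h4⟩ := he
  interval_cases e₁ <;> interval_cases e₂ <;> cases hs <;> cases ht <;>
    first | decide +kernel | omega

-- The same comparison across the middle line: the row above `k + 1` is the half turn of row `k + 1`
-- itself.
set_option maxHeartbeats 2000000 in
theorem LowerSpec.fits_rotate {w k I : ℤ} (hk : 1 ≤ k) (hw : 2 * k + 5 ≤ w)
    {e₁ : ℤ} (h1 : -1 ≤ e₁) (h2 : e₁ ≤ 1) {s t : Tile} {q q' : ℤ × ℤ}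
    (hs : LowerSpec w k I (k + 1) s q) (ht : LowerSpec w k (w - 1 - (I + e₁)) (k + 1) t q') :
    Fits (e₁, 1) q s (t.1, t.2 + 2) := by
  interval_cases e₁ <;> cases hs <;> cases ht <;> first | decide +kernel | omega

theorem sum_moveCount_spiralTile {w k I J : ℤ} (hk : 1 ≤ k) (hw : 2 * k + 5 ≤ w) (hJ : J ≤ k + 1)
    {c : ℤ × ℤ} (hc : c ∈ (spiralTile w k I J).cells) :
    ∑ e ∈ Finset.Icc (-1 : ℤ) 1 ×ˢ Finset.Icc (-1 : ℤ) 1,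
      moveCount c e (spiralTile w k (I + e.1) (J + e.2)) = 2 := by
  obtain ⟨q, hq⟩ := exists_lowerSpec w k I J
  rw [spiralTile, if_pos hJ] at hc
  rw [← hq.sum_moveCount c hc]
  refine Finset.sum_congr rfl fun e he => ?_
  suffices Fits e q (lowerTile w k I J) (spiralTile w k (I + e.1) (J + e.2)) from this c hc
  rw [spiralTile]
  split_ifs with h
  · obtain ⟨q', hq'⟩ := exists_lowerSpec w k (I + e.1) (J + e.2)
    exact hq.fits hk hw hJ he h hq'
  · obtain ⟨e₁, e₂⟩ := e
    simp only [Finset.mem_product, Finset.mem_Icc] at he h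
    obtain rfl : J = k + 1 := by omega
    obtain rfl : e₂ = 1 := by omega
    have h5 : 2 * k + 3 - (k + 1 + 1) = k + 1 := by ring
    simp only [h5]
    obtain ⟨q', hq'⟩ := exists_lowerSpec w k (w - 1 - (I + e₁)) (k + 1)
    exact hq.fits_rotate hk hw he.1.1 he.1.2 hq'

/-! ### Half-turn symmetry and the cells of the spiral -/

theorem mem_cells_rotate {t : Tile} {c : ℤ × ℤ} :
    (3 - c.1, 3 - c.2) ∈ Tile.cells (t.1, t.2 + 2) ↔ c ∈ t.cells := by
  obtain ⟨s, r⟩ := t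
  obtain ⟨a, b⟩ := c
  simp only [Tile.cells, List.mem_map]
  refine exists_congr fun d => and_congr_right fun _ => ?_
  fin_cases r <;> simp [turnCell, Prod.ext_iff] <;> omega

theorem spiralTile_rotate (w k I J : ℤ) :
    spiralTile w k (w - 1 - I) (2 * k + 3 - J) =
      ((spiralTile w k I J).1, (spiralTile w k I J).2 + 2) := by
  have h2 : ∀ r : Fin 4, r + 2 + 2 = r := by decide
  have h3 : w - 1 - (w - 1 - I) = I := by ring
  have h4 : 2 * k + 3 - (2 * k + 3 - J) = J := by ring
  unfold spiralTile
  rw [h3, h4]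
  split_ifs with h h' h'
  · omega
  · simp only [h2]
  · rfl
  · omega

theorem tileMem_rotate (w k : ℤ) (p : ℤ × ℤ) :
    TileMem (spiralTile w k) (4 * w - 1 - p.1, 8 * k + 15 - p.2) ↔
      TileMem (spiralTile w k) p := by
  have h1 : (4 * w - 1 - p.1) % 4 = 3 - p.1 % 4 := by omega
  have h2 : (4 * w - 1 - p.1) / 4 = w - 1 - p.1 / 4 := by omega
  have h3 : (8 * k + 15 - p.2) % 4 = 3 - p.2 % 4 := by omega
  have h4 : (8 * k + 15 - p.2) / 4 = 2 * k + 3 - p.2 / 4 := by omega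
  simp only [TileMem, h1, h2, h3, h4, spiralTile_rotate]
  exact mem_cells_rotate (c := (p.1 % 4, p.2 % 4))

theorem LowerSpec.bounds {w k I J : ℤ} {t : Tile} {q c : ℤ × ℤ} (h : LowerSpec w k I J t q)
    (hc : c ∈ t.cells) : 0 ≤ J ∧ 1 ≤ I ∧ I ≤ w - 2 := by
  cases h <;> first | omega | simp [Tile.cells, Shape.cells] at hc

theorem spiralTile_bounds {w k I J : ℤ} (hk : 1 ≤ k) {c : ℤ × ℤ}
    (hc : c ∈ (spiralTile w k I J).cells) :
    (0 ≤ J ∧ J ≤ 2 * k + 3) ∧ 1 ≤ I ∧ I ≤ w - 2 := by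
  unfold spiralTile at hc
  split_ifs at hc with h
  · obtain ⟨q, hq⟩ := exists_lowerSpec w k I J
    have := hq.bounds hc
    omega
  · obtain ⟨q, hq⟩ := exists_lowerSpec w k (w - 1 - I) (2 * k + 3 - J)
    have hc' : (3 - (3 - c.1), 3 - (3 - c.2)) ∈ Tile.cells
      ((lowerTile w k (w - 1 - I) (2 * k + 3 - J)).1,
        (lowerTile w k (w - 1 - I) (2 * k + 3 - J)).2 + 2) := by simpa using hc
    have := hq.bounds (mem_cells_rotate (c := (3 - c.1, 3 - c.2)).1 hc')
    omega

/-- The cells of a square spiral. -/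
noncomputable def spiral (w k : ℤ) : Finset (ℤ × ℤ) :=
  (Finset.Ico 4 (4 * (w - 1)) ×ˢ Finset.Ico 0 (8 * k + 16)).filter (TileMem (spiralTile w k))

theorem mem_spiral {w k : ℤ} (hk : 1 ≤ k) {p : ℤ × ℤ} :
    p ∈ spiral w k ↔ TileMem (spiralTile w k) p := by
  rw [spiral, Finset.mem_filter, and_iff_right_iff_imp]
  intro h
  have := spiralTile_bounds hk h
  simp only [Finset.mem_product, Finset.mem_Ico]
  omega

theorem knightAdj_iff_mem_knightMoves {p q : ℤ × ℤ} : KnightAdj p q ↔ q - p ∈ knightMoves := by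
  obtain ⟨a, b⟩ := p
  obtain ⟨c, d⟩ := q
  simp only [KnightAdj, knightMoves, Finset.mem_insert, Finset.mem_singleton, Prod.ext_iff,
    Prod.fst_sub, Prod.snd_sub, abs_eq (zero_le_one (α := ℤ)),
    abs_eq (zero_le_two (α := ℤ))]
  constructor
  · rintro (⟨h1 | h1, h2 | h2⟩ | ⟨h1 | h1, h2 | h2⟩) <;> omega
  · rintro (h | h | h | h | h | h | h | h) <;> omega

theorem knightDegree_eq_card_moves (S : Finset (ℤ × ℤ)) (v : ℤ × ℤ) :
    knightDegree S v = (knightMoves.filter fun d => v + d ∈ S).card := by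
  refine Finset.card_bij' (fun u _ => u - v) (fun d _ => v + d) ?_ ?_ ?_ ?_
  · intro u hu
    obtain ⟨h1, h2⟩ := Finset.mem_filter.1 hu
    exact Finset.mem_filter.2 ⟨knightAdj_iff_mem_knightMoves.1 h2, by simpa using h1⟩
  · intro d hd
    obtain ⟨h1, h2⟩ := Finset.mem_filter.1 hd
    exact Finset.mem_filter.2 ⟨h2, knightAdj_iff_mem_knightMoves.2 (by simpa using h1)⟩
  · simp
  · simp

/-- The moves are sorted by the tile in which they land; coordinates change by at most 2, so this is
the same tile or one of its eight neighbours. -/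
theorem knightDegree_eq_sum_moveCount {S : Finset (ℤ × ℤ)} {T : ℤ → ℤ → Tile}
    (hS : ∀ p, p ∈ S ↔ TileMem T p) (v : ℤ × ℤ) :
    knightDegree S v = ∑ e ∈ Finset.Icc (-1 : ℤ) 1 ×ˢ Finset.Icc (-1 : ℤ) 1,
      moveCount (v.1 % 4, v.2 % 4) e (T (v.1 / 4 + e.1) (v.2 / 4 + e.2)) := by
  rw [knightDegree_eq_card_moves, Finset.card_eq_sum_card_fiberwise
    (f := fun d => ((v.1 % 4 + d.1) / 4, (v.2 % 4 + d.2) / 4))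
    (t := Finset.Icc (-1 : ℤ) 1 ×ˢ Finset.Icc (-1 : ℤ) 1)]
  · refine Finset.sum_congr rfl fun e _ => ?_
    rw [moveCount, Finset.filter_filter]
    congr 1
    refine Finset.filter_congr fun d _ => ?_
    rw [hS, TileMem, and_comm]
    refine and_congr_right ?_
    rintro rfl
    have h1 : (v + d).1 % 4 = (v.1 % 4 + d.1) % 4 := by simp
    have h2 : (v + d).2 % 4 = (v.2 % 4 + d.2) % 4 := by simp
    have h3 : (v + d).1 / 4 = v.1 / 4 + (v.1 % 4 + d.1) / 4 := by
      rw [Prod.fst_add]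
      omega
    have h4 : (v + d).2 / 4 = v.2 / 4 + (v.2 % 4 + d.2) / 4 := by
      rw [Prod.snd_add]
      omega
    simp only [h1, h2, h3, h4]
  · intro d hd
    have hb : ∀ d ∈ knightMoves, (-2 ≤ d.1 ∧ d.1 ≤ 2) ∧ (-2 ≤ d.2 ∧ d.2 ≤ 2) := by decide
    have := hb d (Finset.mem_filter.1 hd).1
    simp only [Finset.coe_product, Finset.coe_Icc, Set.mem_prod, Set.mem_Icc]
    omega

theorem knightDegree_rotate {S : Finset (ℤ × ℤ)} {q : ℤ × ℤ} (hS : ∀ p, q - p ∈ S ↔ p ∈ S)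
    (v : ℤ × ℤ) : knightDegree S (q - v) = knightDegree S v := by
  refine Finset.card_bij' (fun u _ => q - u) (fun u _ => q - u) ?_ ?_ ?_ ?_
  · intro u hu
    obtain ⟨h1, h2⟩ := Finset.mem_filter.1 hu
    refine Finset.mem_filter.2 ⟨(hS u).2 h1, KnightAdj.symm ?_⟩
    rw [knightAdj_iff_mem_knightMoves] at h2 ⊢
    simpa [sub_sub_eq_add_sub, add_comm] using h2
  · intro u hu
    obtain ⟨h1, h2⟩ := Finset.mem_filter.1 hu
    refine Finset.mem_filter.2 ⟨(hS u).2 h1, KnightAdj.symm ?_⟩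
    rw [knightAdj_iff_mem_knightMoves] at h2 ⊢
    simpa using h2
  · simp
  · simp

theorem spiral_rotate {w k : ℤ} (hk : 1 ≤ k) (p : ℤ × ℤ) :
    (4 * w - 1, 8 * k + 15) - p ∈ spiral w k ↔ p ∈ spiral w k := by
  rw [mem_spiral hk, mem_spiral hk]
  exact tileMem_rotate w k p

theorem knightDegree_spiral {w k : ℤ} (hk : 1 ≤ k) (hw : 2 * k + 5 ≤ w) {v : ℤ × ℤ}
    (hv : v ∈ spiral w k) : knightDegree (spiral w k) v = 2 := by
  have key : ∀ v ∈ spiral w k, v.2 / 4 ≤ k + 1 → knightDegree (spiral w k) v = 2 := by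
    intro v hv hJ
    rw [knightDegree_eq_sum_moveCount (fun p => mem_spiral hk) v]
    exact sum_moveCount_spiralTile hk hw hJ ((mem_spiral hk).1 hv)
  rcases le_or_gt (v.2 / 4) (k + 1) with h | h
  · exact key v hv h
  · rw [← knightDegree_rotate (spiral_rotate hk)]
    refine key _ ((spiral_rotate hk v).2 hv) ?_
    rw [Prod.snd_sub]
    omega

/-! ### Size of the spiral -/

theorem spiralTile_eq_straight {w k I J : ℤ} (hJ : 1 ≤ J ∧ J ≤ k) (hI : 1 ≤ I ∧ I ≤ w - 2)
    (h1 : I ≠ J - 1) (h2 : I ≠ J) (h3 : I ≠ w - 2 - J) (h4 : I ≠ w - 1 - J) :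
    (spiralTile w k I J).1 = .straight := by
  rw [spiralTile, if_pos (by omega)]
  obtain ⟨q, hq⟩ := exists_lowerSpec w k I J
  generalize lowerTile w k I J = t at *
  cases hq <;> first | rfl | omega

theorem card_cells_straight : ∀ t : Tile, t.1 = .straight → t.cells.toFinset.card = 8 := by
  rintro ⟨s, r⟩ h
  obtain rfl : s = .straight := h
  fin_cases r <;> decide

theorem card_cells_le_card_fiber {S : Finset (ℤ × ℤ)} {T : ℤ → ℤ → Tile}
    (hS : ∀ p, TileMem T p → p ∈ S) (i : ℤ × ℤ) :
    (T i.1 i.2).cells.toFinset.card ≤ (S.filter fun p => (p.1 / 4, p.2 / 4) = i).card := by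
  refine Finset.card_le_card_of_injOn (fun c => (4 * i.1 + c.1, 4 * i.2 + c.2)) ?_ ?_
  · intro c hc
    have hc := List.mem_toFinset.1 hc
    have hb := cells_bounds _ c hc
    refine Finset.mem_coe.2 (Finset.mem_filter.2 ⟨hS _ ?_, ?_⟩)
    · exact (tileMem_add T _ _ _ _ hb.1 hb.2).2 hc
    · ext <;> simp only <;> omega
  · intro c _ d _ h
    simp only [Prod.mk.injEq] at h
    ext <;> omega

/-- Each of the `k` rows has `w - 2` places, of which at most four, the starts and turns at the
corners, are not straight. -/
theorem le_card_straight {w k : ℤ} (hk : 1 ≤ k) (hw : 2 * k + 5 ≤ w) :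
    k * (w - 6) ≤ ((Finset.Icc 1 (w - 2) ×ˢ Finset.Icc 1 k).filter fun i =>
      (spiralTile w k i.1 i.2).1 = .straight).card := by
  set B := Finset.Icc 1 (w - 2) ×ˢ Finset.Icc 1 k
  set G := B.filter fun i => (spiralTile w k i.1 i.2).1 = .straight
  set f : ℤ → Finset (ℤ × ℤ) := fun J => {(J - 1, J), (J, J), (w - 2 - J, J), (w - 1 - J, J)}
  have hsub : B ⊆ G ∪ (Finset.Icc 1 k).biUnion f := by
    intro i hi
    by_contra h
    simp only [Finset.mem_union, not_or, Finset.mem_biUnion, not_exists, not_and, G,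
      Finset.mem_filter] at h
    obtain ⟨h1, h2⟩ := Finset.mem_product.1 hi
    rw [Finset.mem_Icc] at h1 h2
    refine h.1 hi (spiralTile_eq_straight h2 h1 ?_ ?_ ?_ ?_) <;> intro h0 <;>
      refine h.2 i.2 (Finset.mem_Icc.2 h2) ?_ <;> simp [f, Prod.ext_iff, h0]
  have h1 := (Finset.card_le_card hsub).trans (Finset.card_union_le _ _)
  have h2 : ((Finset.Icc 1 k).biUnion f).card ≤ (Finset.Icc 1 k).card * 4 :=
    Finset.card_biUnion_le_card_mul _ _ _ fun J _ => Finset.card_le_four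
  rw [Finset.card_product] at h1
  simp only [Int.card_Icc] at h1 h2
  have h3 : ((w - 2 + 1 - 1).toNat : ℤ) = w - 2 := by omega
  have h4 : ((k + 1 - 1).toNat : ℤ) = k := by omega
  zify [h3, h4] at h1 h2
  linarith

/-- Eight cells per straight tile in the lower half, doubled by the half turn. -/
theorem le_card_spiral {w k : ℤ} (hk : 1 ≤ k) (hw : 2 * k + 5 ≤ w) :
    16 * (k * (w - 6)) ≤ (spiral w k).card := by
  set G := (Finset.Icc 1 (w - 2) ×ˢ Finset.Icc 1 k).filter fun i =>
    (spiralTile w k i.1 i.2).1 = .straight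
  set L := (spiral w k).filter fun p => p.2 / 4 ≤ k + 1
  have h1 : 8 * G.card ≤ L.card := by
    have hle := Finset.sum_le_sum (s := G) (f := fun _ => 8) (g := fun i =>
      (L.filter fun p => (p.1 / 4, p.2 / 4) = i).card) fun i hi => ?_
    · rw [Finset.sum_const, smul_eq_mul, mul_comm] at hle
      simp only [Finset.card_eq_sum_ones L, Finset.card_eq_sum_ones (L.filter _)] at hle ⊢
      exact hle.trans (Finset.sum_fiberwise_le_sum_of_sum_fiber_nonneg fun _ _ => Nat.zero_le _)
    · obtain ⟨hi, hs⟩ := Finset.mem_filter.1 hi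
      have hi := (Finset.mem_product.1 hi).2
      rw [Finset.mem_Icc] at hi
      rw [← card_cells_straight _ hs]
      refine (card_cells_le_card_fiber (fun p => (mem_spiral hk).2) i).trans (Finset.card_le_card ?_)
      intro p hp
      obtain ⟨hp, h⟩ := Finset.mem_filter.1 hp
      refine Finset.mem_filter.2 ⟨Finset.mem_filter.2 ⟨hp, ?_⟩, h⟩
      rw [Prod.ext_iff] at h
      simp only at h
      omega
  have h2 : L.card ≤ ((spiral w k).filter fun p => ¬ p.2 / 4 ≤ k + 1).card := by
    refine Finset.card_le_card_of_injOn (fun p => (4 * w - 1, 8 * k + 15) - p) ?_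
      (sub_right_injective.injOn)
    intro p hp
    obtain ⟨hp, h⟩ := Finset.mem_filter.1 hp
    refine Finset.mem_coe.2 (Finset.mem_filter.2 ⟨(spiral_rotate hk p).2 hp, ?_⟩)
    rw [Prod.snd_sub]
    omega
  have h3 := Finset.card_filter_add_card_filter_not (s := spiral w k) fun p => p.2 / 4 ≤ k + 1
  have h4 := le_card_straight hk hw
  zify at h1 h2 h3
  linarith

/-! ### Connectedness of the square spiral -/

/-- Two cells are joined by knight moves through cells satisfying `M`, or are equal. -/
def Linked (M : ℤ × ℤ → Prop) : ℤ × ℤ → ℤ × ℤ → Prop :=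
  Relation.EqvGen fun u v => M u ∧ M v ∧ KnightAdj u v

namespace Linked

variable {M : ℤ × ℤ → Prop} {p q r : ℤ × ℤ}

theorem refl (p : ℤ × ℤ) : Linked M p p := Relation.EqvGen.refl p

theorem symm (h : Linked M p q) : Linked M q p := Relation.EqvGen.symm _ _ h

theorem trans (h : Linked M p q) (h' : Linked M q r) : Linked M p r :=
  Relation.EqvGen.trans _ _ _ h h'

theorem move {a b c d : ℤ} (x y : ℤ) (hp : M (a, b)) (hq : M (c, d))
    (h₁ : c = a + x := by omega) (h₂ : d = b + y := by omega)
    (h : (x, y) ∈ knightMoves := by decide) : Linked M (a, b) (c, d) := by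
  refine Relation.EqvGen.rel _ _ ⟨hp, hq, knightAdj_iff_mem_knightMoves.2 ?_⟩
  have : ((c, d) : ℤ × ℤ) - (a, b) = (x, y) := by
    simp only [Prod.mk_sub_mk, Prod.mk.injEq]
    omega
  rwa [this]

theorem map {N : ℤ × ℤ → Prop} (f : ℤ × ℤ → ℤ × ℤ) (hM : ∀ p, M p → N (f p))
    (hf : ∀ p q, KnightAdj p q → KnightAdj (f p) (f q)) (h : Linked M p q) :
    Linked N (f p) (f q) := by
  induction h with
  | rel u v h => exact .rel _ _ ⟨hM _ h.1, hM _ h.2.1, hf _ _ h.2.2⟩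
  | refl u => exact .refl _
  | symm u v _ ih => exact ih.symm
  | trans u v w _ _ ih₁ ih₂ => exact Linked.trans ih₁ ih₂

end Linked

theorem knightConnected_of_linked {S : Finset (ℤ × ℤ)} {p : ℤ × ℤ}
    (h : ∀ q ∈ S, Linked (· ∈ S) p q) : KnightConnected S := by
  intro U hU ⟨u, hu⟩ hclosed
  have key : ∀ a b, Linked (· ∈ S) a b → (a ∈ U ↔ b ∈ U) := by
    intro a b hab
    induction hab with
    | rel a b h => exact ⟨fun ha => hclosed a ha b h.2.1 h.2.2,
        fun hb => hclosed b hb a h.1 h.2.2.symm⟩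
    | refl a => rfl
    | symm a b _ ih => exact ih.symm
    | trans a b c _ _ ih₁ ih₂ => exact ih₁.trans ih₂
  refine Finset.Subset.antisymm hU fun q hq => ?_
  exact (key u q ((h u (hU hu)).symm.trans (h q hq))).1 hu

/-- A column of straight tiles between a start and a turn. -/
structure IsPillar (T : ℤ → ℤ → Tile) (I J h : ℤ) : Prop where
  two_le : 2 ≤ h
  start : T I J = (.start, 1)
  straight : ∀ j, J < j → j < J + h → T I j = (.straight, 2)
  turn : T I (J + h) = (.turn, 2)

/-- The path enters at cell (0,3) of the start tile, runs up, down, up and down along the four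
strands, and leaves at cell (3,1) of the start tile. -/
theorem IsPillar.linked {T : ℤ → ℤ → Tile} {I J h : ℤ} (hT : IsPillar T I J h) {j : ℤ}
    (hj : J ≤ j) (hj' : j ≤ J + h) {c : ℤ × ℤ} (hc : c ∈ (T I j).cells) :
    Linked (TileMem T) (4 * I, 4 * J + 3) (4 * I + c.1, 4 * j + c.2) := by
  obtain ⟨hh, hD, hV, hU⟩ := hT
  set M := TileMem T
  have mD : ∀ a b, (a, b) ∈ Tile.cells (.start, 1) → M (4 * I + a, 4 * J + b) := by
    intro a b hab
    have hb := cells_bounds _ _ hab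
    exact (tileMem_add T I J a b hb.1 hb.2).2 (hD ▸ hab)
  have mU : ∀ a b, (a, b) ∈ Tile.cells (.turn, 2) → M (4 * I + a, 4 * (J + h) + b) := by
    intro a b hab
    have hb := cells_bounds _ _ hab
    exact (tileMem_add T I (J + h) a b hb.1 hb.2).2 (hU ▸ hab)
  have mV : ∀ a y, 2 ≤ a → a ≤ 3 → 4 ≤ y → y < 4 * h → M (4 * I + a, 4 * J + y) := by
    intro a y ha ha' hy hy'
    have e : 4 * J + y = 4 * (J + y / 4) + y % 4 := by omega
    rw [e]
    refine (tileMem_add T I (J + y / 4) a (y % 4) (by omega) (by omega)).2 ?_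
    rw [hV _ (by omega) (by omega)]
    have h0 : 0 ≤ y % 4 := by omega
    have h4 : y % 4 < 4 := by omega
    generalize y % 4 = b at *
    interval_cases a <;> interval_cases b <;> decide
  -- Each move climbs two rows and switches between the columns 2 and 3; the parities of the row and
  -- of the initial column `e` select the strand.
  have strand : ∀ e y : ℤ, 4 ≤ y → ∀ t : ℕ, y + 2 * t < 4 * h →
      Linked M (4 * I + (2 + e % 2), 4 * J + y)
        (4 * I + (2 + (e + t) % 2), 4 * J + (y + 2 * t)) := by
    intro e y hy t
    induction t with
    | zero => intro _; simpa using Linked.refl _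
    | succ t ih =>
      intro ht
      push_cast at ht ⊢
      refine (ih (by omega)).trans ?_
      have m1 := mV (2 + (e + t) % 2) (y + 2 * t) (by omega) (by omega) (by omega) (by omega)
      have m2 := mV (2 + (e + (t + 1)) % 2) (y + 2 * (t + 1)) (by omega) (by omega) (by omega)
        (by omega)
      obtain h0 | h0 : (e + t) % 2 = 0 ∨ (e + t) % 2 = 1 := by omega
      · exact .move 1 2 m1 m2
      · exact .move (-1) 2 m1 m2
  -- A whole strand takes `2 * h - 3` moves, an odd number, so it ends in the other column.
  have top : ∀ a a' y z : ℤ, (a = 2 ∧ a' = 3 ∨ a = 3 ∧ a' = 2) → (4 ≤ y ∧ y ≤ 5) → z = y - 6 →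
      Linked M (4 * I + a, 4 * J + y) (4 * I + a', 4 * (J + h) + z) := by
    intro a a' y z ha hy hz
    have := strand a y hy.1 (2 * h - 3).toNat (by omega)
    have e0 : 2 + a % 2 = a := by omega
    have e1 : 2 + (a + ((2 * h - 3).toNat : ℤ)) % 2 = a' := by omega
    have e2 : 4 * J + (y + 2 * ((2 * h - 3).toNat : ℤ)) = 4 * (J + h) + z := by omega
    rwa [e0, e1, e2] at this
  have mT : ∀ a y, 2 ≤ a → a ≤ 3 → -2 ≤ y → y < 0 → M (4 * I + a, 4 * (J + h) + y) := by
    intro a y h1 h2 h3 h4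
    have := mV a (4 * h + y) h1 h2 (by omega) (by omega)
    rwa [← add_assoc, ← mul_add] at this
  -- the chain through the pillar
  have d03 := mD 0 3 (by decide)
  have d13 := mD 1 3 (by decide)
  have d23 := mD 2 3 (by decide)
  have d31 := mD 3 1 (by decide)
  have u00 := mU 0 0 (by decide)
  have u20 := mU 2 0 (by decide)
  have u30 := mU 3 0 (by decide)
  have u01 := mU 0 1 (by decide)
  have u21 := mU 2 1 (by decide)
  have u22 := mU 2 2 (by decide)
  have b0 := fun y h1 h2 => mV 2 y (by omega) (by omega) h1 (h2 : y < 4 * h)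
  have b1 := fun y h1 h2 => mV 3 y (by omega) (by omega) h1 (h2 : y < 4 * h)
  have t0 := fun y h1 h2 => mT 2 y (by omega) (by omega) h1 h2
  have t1 := fun y h1 h2 => mT 3 y (by omega) (by omega) h1 h2
  set o : ℤ × ℤ := (4 * I, 4 * J + 3) with ho
  have l03 : Linked M o (4 * I + 0, 4 * J + 3) := by rw [add_zero]; exact .refl _
  have l24 : Linked M o (4 * I + 2, 4 * J + 4) :=
    l03.trans (.move 2 1 d03 (b0 4 (by omega) (by omega)))
  have lu20 : Linked M o (4 * I + 2, 4 * (J + h) + 0) :=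
    (l24.trans (top 2 3 4 (-2) (by decide) (by decide) (by decide))).trans
      (.move (-1) 2 (t1 (-2) (by omega) (by omega)) u20)
  have lu01 := lu20.trans (.move (-2) 1 u20 u01)
  have lu22 := lu01.trans (.move 2 1 u01 u22)
  have lu30 := lu22.trans (.move 1 (-2) u22 u30)
  have l34 : Linked M o (4 * I + 3, 4 * J + 4) :=
    (lu30.trans (.move (-1) (-2) u30 (t0 (-2) (by omega) (by omega)))).trans
      (top 3 2 4 (-2) (by decide) (by decide) (by decide)).symm
  have l13 := l34.trans (.move (-2) (-1) (b1 4 (by omega) (by omega)) d13)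
  have l25 : Linked M o (4 * I + 2, 4 * J + 5) :=
    l13.trans (.move 1 2 d13 (b0 5 (by omega) (by omega)))
  have lu21 : Linked M o (4 * I + 2, 4 * (J + h) + 1) :=
    (l25.trans (top 2 3 5 (-1) (by decide) (by decide) (by decide))).trans
      (.move (-1) 2 (t1 (-1) (by omega) (by omega)) u21)
  have lu00 := lu21.trans (.move (-2) (-1) u21 u00)
  have l35 : Linked M o (4 * I + 3, 4 * J + 5) :=
    (lu00.trans (.move 2 (-1) u00 (t0 (-1) (by omega) (by omega)))).trans
      (top 3 2 5 (-1) (by decide) (by decide) (by decide)).symm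
  have l23 := l35.trans (.move (-1) (-2) (b1 5 (by omega) (by omega)) d23)
  have l31 := l23.trans (.move 1 (-2) d23 d31)
  obtain ⟨a, b⟩ := c
  obtain rfl | rfl | ⟨h1, h2⟩ : j = J ∨ j = J + h ∨ J < j ∧ j < J + h := by omega
  · rw [hD] at hc
    have hc' : (a, b) ∈ [((3 : ℤ), (1 : ℤ)), (2, 3), (1, 3), (0, 3)] := hc
    simp only [List.mem_cons, Prod.mk.injEq, List.not_mem_nil, or_false] at hc'
    obtain ⟨rfl, rfl⟩ | ⟨rfl, rfl⟩ | ⟨rfl, rfl⟩ | ⟨rfl, rfl⟩ := hc' <;> assumption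
  · rw [hU] at hc
    have hc' : (a, b) ∈ [((2 : ℤ), (2 : ℤ)), (2, 1), (0, 1), (3, 0), (2, 0), (0, 0)] := hc
    simp only [List.mem_cons, Prod.mk.injEq, List.not_mem_nil, or_false] at hc'
    obtain ⟨rfl, rfl⟩ | ⟨rfl, rfl⟩ | ⟨rfl, rfl⟩ | ⟨rfl, rfl⟩ | ⟨rfl, rfl⟩ | ⟨rfl, rfl⟩ := hc' <;>
      assumption
  · rw [hV j h1 h2] at hc
    have hab : (2 ≤ a ∧ a ≤ 3) ∧ 0 ≤ b ∧ b ≤ 3 := by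
      have : ∀ c ∈ Tile.cells (.straight, 2), (2 ≤ c.1 ∧ c.1 ≤ 3) ∧ 0 ≤ c.2 ∧ c.2 ≤ 3 := by decide
      exact this _ hc
    -- The number of moves from the bottom of the strand, in row `4 + b % 2`, up to the given cell.
    set t := (2 * (j - J) + b / 2 - 2).toNat with ht
    have hl : ∀ e : ℤ, (e = 0 ∨ e = 1) →
        Linked M o (4 * I + (2 + e % 2), 4 * J + (4 + b % 2)) := by
      rintro e he
      obtain hb | hb : b % 2 = 0 ∨ b % 2 = 1 := by omega
      · rw [hb]; obtain rfl | rfl := he <;> assumption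
      · rw [hb]; obtain rfl | rfl := he <;> assumption
    have := (hl ((a + t) % 2) (by omega)).trans
      (strand ((a + t) % 2) (4 + b % 2) (by omega) t (by omega))
    have e1 : 2 + ((a + t) % 2 + (t : ℤ)) % 2 = a := by omega
    have e2 : 4 * J + (4 + b % 2 + 2 * (t : ℤ)) = 4 * j + b := by omega
    rwa [e1, e2] at this

theorem mem_cells_rotate_quarter {t : Tile} {c : ℤ × ℤ} :
    c ∈ Tile.cells (t.1, t.2 + 1) ↔ (c.2, 3 - c.1) ∈ t.cells := by
  obtain ⟨s, r⟩ := t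
  obtain ⟨a, b⟩ := c
  simp only [Tile.cells, List.mem_map]
  refine exists_congr fun d => and_congr_right fun _ => ?_
  fin_cases r <;> simp [turnCell, Prod.ext_iff] <;> omega

theorem knightAdj_rotate_half (q : ℤ × ℤ) {p p' : ℤ × ℤ} (h : KnightAdj p p') :
    KnightAdj (q - p) (q - p') := by
  simpa [KnightAdj, abs_sub_comm] using h

theorem knightAdj_rotate_quarter {p p' : ℤ × ℤ} (h : KnightAdj p p') :
    KnightAdj (p.2, 3 - p.1) (p'.2, 3 - p'.1) := by
  simp only [KnightAdj, sub_sub_sub_cancel_left] at *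
  rw [abs_sub_comm p'.1]
  tauto

section Spiral

variable {w k : ℤ}

theorem exists_lowerSpec_spiralTile (w k I : ℤ) {J : ℤ} (hJ : J ≤ k + 1) :
    ∃ q, LowerSpec w k I J (spiralTile w k I J) q := by
  rw [spiralTile, if_pos hJ]
  exact exists_lowerSpec w k I J

/-- An east side crosses the middle line: its upper part is read off from a west side through the
half turn. -/
theorem isPillar_east (hw : 2 * k + 5 ≤ w) {i : ℤ} (hi : 1 ≤ i) (hik : i ≤ k) :
    IsPillar (spiralTile w k) (w - 1 - i) i (2 * k + 2 - 2 * i) := by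
  have hlow : ∀ J, i < J → J ≤ k + 1 → spiralTile w k (w - 1 - i) J = (.straight, 2) := by
    intro J h1 h2
    obtain ⟨q, hq⟩ := exists_lowerSpec_spiralTile w k (w - 1 - i) h2
    generalize spiralTile w k (w - 1 - i) J = t at *
    cases hq <;> first | rfl | omega
  have hrot : ∀ J, spiralTile w k (w - 1 - i) J =
      ((spiralTile w k i (2 * k + 3 - J)).1, (spiralTile w k i (2 * k + 3 - J)).2 + 2) := by
    intro J
    have := spiralTile_rotate w k i (2 * k + 3 - J)
    rwa [sub_sub_cancel] at this
  refine ⟨by omega, ?_, fun j h1 h2 => ?_, ?_⟩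
  · obtain ⟨q, hq⟩ := exists_lowerSpec_spiralTile w k (w - 1 - i) (J := i) (by omega)
    generalize spiralTile w k (w - 1 - i) i = t at *
    cases hq <;> first | rfl | omega
  · rcases le_or_gt j (k + 1) with h | h
    · exact hlow j h1 h
    · rw [hrot]
      obtain ⟨q, hq⟩ := exists_lowerSpec_spiralTile w k i (J := 2 * k + 3 - j) (by omega)
      generalize spiralTile w k i (2 * k + 3 - j) = t at *
      cases hq <;> first | rfl | omega
  · rw [hrot]
    obtain ⟨q, hq⟩ := exists_lowerSpec_spiralTile w k i
      (J := 2 * k + 3 - (i + (2 * k + 2 - 2 * i))) (by omega)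
    generalize spiralTile w k i (2 * k + 3 - (i + (2 * k + 2 - 2 * i))) = t at *
    cases hq <;> first | rfl | omega

/-- The pattern of tiles turned by a quarter. -/
def rotateTiles (T : ℤ → ℤ → Tile) (I J : ℤ) : Tile := ((T J (-I)).1, (T J (-I)).2 + 1)

theorem TileMem.of_rotateTiles {T : ℤ → ℤ → Tile} {p : ℤ × ℤ} (h : TileMem (rotateTiles T) p) :
    TileMem T (p.2, 3 - p.1) := by
  have h1 : (3 - p.1) / 4 = -(p.1 / 4) := by omega
  have h2 : (3 - p.1) % 4 = 3 - p.1 % 4 := by omega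
  simp only [TileMem, h1, h2]
  exact mem_cells_rotate_quarter.1 h

/-- After a quarter turn a south side is a pillar too, so the analysis of the four strands is done
only once. -/
theorem isPillar_south (hw : 2 * k + 5 ≤ w) {i : ℤ} (hi : 1 ≤ i) (hik : i ≤ k) :
    IsPillar (rotateTiles (spiralTile w k)) (-i) i (w - 2 - 2 * i) := by
  refine ⟨by omega, ?_, fun j h1 h2 => ?_, ?_⟩
  all_goals rw [rotateTiles, neg_neg]
  · obtain ⟨q, hq⟩ := exists_lowerSpec_spiralTile w k i (J := i) (by omega)
    generalize spiralTile w k i i = t at *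
    cases hq <;> first | rfl | omega
  · obtain ⟨q, hq⟩ := exists_lowerSpec_spiralTile w k j (J := i) (by omega)
    generalize spiralTile w k j i = t at *
    cases hq <;> first | rfl | omega
  · obtain ⟨q, hq⟩ := exists_lowerSpec_spiralTile w k (i + (w - 2 - 2 * i)) (J := i) (by omega)
    generalize spiralTile w k (i + (w - 2 - 2 * i)) i = t at *
    cases hq <;> first | rfl | omega

theorem linked_east_pillar (hw : 2 * k + 5 ≤ w) {i : ℤ} (hi : 1 ≤ i) (hik : i ≤ k) {j : ℤ}
    (hj : i ≤ j) (hj' : j ≤ 2 * k + 2 - i) {c : ℤ × ℤ}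
    (hc : c ∈ (spiralTile w k (w - 1 - i) j).cells) :
    Linked (TileMem (spiralTile w k)) (4 * (w - 1 - i), 4 * i + 3)
      (4 * (w - 1 - i) + c.1, 4 * j + c.2) :=
  (isPillar_east hw hi hik).linked hj (by omega) hc

theorem linked_south_pillar (hw : 2 * k + 5 ≤ w) {i : ℤ} (hi : 1 ≤ i) (hik : i ≤ k) {j : ℤ}
    (hj : i ≤ j) (hj' : j ≤ w - 2 - i) {c : ℤ × ℤ} (hc : c ∈ (spiralTile w k j i).cells) :
    Linked (TileMem (spiralTile w k)) (4 * i + 3, 4 * i + 3) (4 * j + c.1, 4 * i + c.2) := by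
  have hc' : (3 - c.2, c.1) ∈ (rotateTiles (spiralTile w k) (-i) j).cells := by
    rw [rotateTiles, neg_neg, mem_cells_rotate_quarter]
    simpa using hc
  have := ((isPillar_south hw hi hik).linked hj (by omega) hc').map (fun p => (p.2, 3 - p.1))
    (fun _ => TileMem.of_rotateTiles) (fun _ _ => knightAdj_rotate_quarter)
  have e1 : 3 - 4 * -i = 4 * i + 3 := by ring
  have e2 : 3 - (4 * -i + (3 - c.2)) = 4 * i + c.2 := by ring
  simpa only [e1, e2] using this

theorem tileMem_of_mem {T : ℤ → ℤ → Tile} {I J : ℤ} {a b : ℤ} (t : Tile) (ht : T I J = t)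
    (hc : (a, b) ∈ t.cells := by decide) : TileMem T (4 * I + a, 4 * J + b) := by
  have hb := cells_bounds _ _ hc
  exact (tileMem_add T I J a b hb.1 hb.2).2 (ht ▸ hc)

/-- Consecutive pillars are joined at their starts: the entrance (0,3) of pillar `i` is a move away
from the exit (3,1) of pillar `i + 1`. -/
theorem linked_east (hw : 2 * k + 5 ≤ w) {i : ℤ} (hi : 1 ≤ i) (hik : i ≤ k) {j : ℤ}
    (hj : i ≤ j) (hj' : j ≤ 2 * k + 2 - i) {c : ℤ × ℤ}
    (hc : c ∈ (spiralTile w k (w - 1 - i) j).cells) :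
    Linked (TileMem (spiralTile w k)) (4 * (w - 2), 7)
      (4 * (w - 1 - i) + c.1, 4 * j + c.2) := by
  refine Linked.trans ?_ (linked_east_pillar hw hi hik hj hj' hc)
  clear hj hj' hc
  induction i, hi using Int.leInduction with
  | base =>
    have e : w - 1 - 1 = w - 2 := by ring
    rw [e]
    exact .refl _
  | succ i hi ih =>
    refine (ih (by omega)).trans (Linked.symm ?_)
    have hs := (isPillar_east hw hi (by omega : i ≤ k)).start
    have hs' := (isPillar_east hw (by omega : 1 ≤ i + 1) hik).start
    refine (linked_east_pillar hw (by omega) hik le_rfl (by omega) (c := (3, 1))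
      (by rw [hs']; decide)).trans ?_
    have m1 := tileMem_of_mem (a := 3) (b := 1) _ hs'
    have m2 := tileMem_of_mem (a := 0) (b := 3) _ hs
    rw [add_zero] at m2
    exact .move 1 (-2) m1 m2

theorem linked_south_aux (hw : 2 * k + 5 ≤ w) {i : ℤ} (hi : 1 ≤ i) (hik : i ≤ k) {j : ℤ}
    (hj : i ≤ j) (hj' : j ≤ w - 2 - i) {c : ℤ × ℤ} (hc : c ∈ (spiralTile w k j i).cells) :
    Linked (TileMem (spiralTile w k)) (7, 7) (4 * j + c.1, 4 * i + c.2) := by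
  refine Linked.trans ?_ (linked_south_pillar hw hi hik hj hj' hc)
  clear hj hj' hc
  have start : ∀ i, 1 ≤ i → i ≤ k → spiralTile w k i i = (.start, 0) := by
    intro i hi hik
    obtain ⟨q, hq⟩ := exists_lowerSpec_spiralTile w k i (J := i) (by omega)
    generalize spiralTile w k i i = t at *
    cases hq <;> first | rfl | omega
  induction i, hi using Int.leInduction with
  | base => exact .refl _
  | succ i hi ih =>
    refine (ih (by omega)).trans (Linked.symm ?_)
    have hs := start i hi (by omega)
    have hs' := start (i + 1) (by omega) hik
    refine (linked_south_pillar hw (by omega) hik le_rfl (by omega) (c := (1, 0))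
      (by rw [hs']; decide)).trans ?_
    exact .move (-2) (-1) (tileMem_of_mem (a := 1) (b := 0) _ hs')
      (tileMem_of_mem (a := 3) (b := 3) _ hs)

theorem tileMem_wireEnd (hk : 1 ≤ k) (hw : 2 * k + 5 ≤ w) {a b : ℤ}
    (hc : (a, b) ∈ Tile.cells (.wireEnd, 0)) :
    TileMem (spiralTile w k) (4 * (w - 2) + a, 4 * 0 + b) := by
  refine tileMem_of_mem (.wireEnd, 0) ?_ hc
  obtain ⟨q, hq⟩ := exists_lowerSpec_spiralTile w k (w - 2) (J := 0) (by omega)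
  generalize spiralTile w k (w - 2) 0 = t at *
  cases hq <;> first | rfl | omega

theorem tileMem_wireStart (hk : 1 ≤ k) (hw : 2 * k + 5 ≤ w) {a b : ℤ}
    (hc : (a, b) ∈ Tile.cells (.wireStart, 0)) :
    TileMem (spiralTile w k) (4 * 1 + a, 4 * 0 + b) := by
  refine tileMem_of_mem (.wireStart, 0) ?_ hc
  obtain ⟨q, hq⟩ := exists_lowerSpec_spiralTile w k 1 (J := 0) (by omega)
  generalize spiralTile w k 1 0 = t at *
  cases hq <;> first | rfl | omega

theorem tileMem_wire (hk : 1 ≤ k) {I : ℤ} (h1 : 2 ≤ I) (h2 : I ≤ w - 3) {a b : ℤ}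
    (hc : (a, b) ∈ Tile.cells (.wire, 0)) :
    TileMem (spiralTile w k) (4 * I + a, 4 * 0 + b) := by
  refine tileMem_of_mem (.wire, 0) ?_ hc
  obtain ⟨q, hq⟩ := exists_lowerSpec_spiralTile w k I (J := 0) (by omega)
  generalize spiralTile w k I 0 = t at *
  cases hq <;> first | rfl | omega

theorem linked_wireEnd (hk : 1 ≤ k) (hw : 2 * k + 5 ≤ w) :
    Linked (TileMem (spiralTile w k)) (4 * (w - 2), 7) (4 * (w - 2) + 2, 4 * 0 + 3) ∧
    Linked (TileMem (spiralTile w k)) (4 * (w - 2), 7) (4 * (w - 2) + 0, 4 * 0 + 2) := by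
  have hs := (isPillar_east hw le_rfl hk).start
  have h1 := linked_east hw le_rfl hk le_rfl (by omega) (c := (3, 1)) (by rw [hs]; decide)
  have m1 := tileMem_of_mem (a := 3) (b := 1) _ hs
  have h2 := h1.trans (.move (-1) (-2) m1 (tileMem_wireEnd hk hw (a := 2) (b := 3) (by decide)))
  exact ⟨h2, h2.trans (.move (-2) (-1) (tileMem_wireEnd hk hw (by decide))
    (tileMem_wireEnd hk hw (by decide)))⟩

/-- The wire runs along row 0 from the outermost east side back to the outermost south side;
induction on `I` goes from right to left. -/
theorem linked_wire (hk : 1 ≤ k) (hw : 2 * k + 5 ≤ w) {I : ℤ} (h1 : 2 ≤ I) (h2 : I ≤ w - 3) :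
    Linked (TileMem (spiralTile w k)) (4 * (w - 2), 7) (4 * I + 3, 4 * 0 + 0) ∧
    Linked (TileMem (spiralTile w k)) (4 * (w - 2), 7) (4 * I + 1, 4 * 0 + 1) := by
  have step : ∀ I, 2 ≤ I → I ≤ w - 3 →
      Linked (TileMem (spiralTile w k)) (4 * I + 3, 4 * 0 + 0) (4 * I + 1, 4 * 0 + 1) :=
    fun I h1 h2 => .move (-2) 1 (tileMem_wire hk h1 h2 (by decide))
      (tileMem_wire hk h1 h2 (by decide))
  suffices h : Linked (TileMem (spiralTile w k)) (4 * (w - 2), 7) (4 * I + 3, 4 * 0 + 0) from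
    ⟨h, h.trans (step I h1 h2)⟩
  induction I, h2 using Int.leInductionDown with
  | base =>
    exact (linked_wireEnd hk hw).2.trans (.move (-1) (-2)
      (tileMem_wireEnd hk hw (by decide)) (tileMem_wire hk h1 le_rfl (by decide)))
  | pred I h2 ih =>
    exact ((ih (by omega)).trans (step I (by omega) h2)).trans (.move (-2) (-1)
      (tileMem_wire hk (by omega) h2 (by decide)) (tileMem_wire hk h1 (by omega) (by decide)))

theorem linked_wireStart (hk : 1 ≤ k) (hw : 2 * k + 5 ≤ w) :
    Linked (TileMem (spiralTile w k)) (4 * (w - 2), 7) (4 * 1 + 3, 4 * 0 + 0) ∧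
    Linked (TileMem (spiralTile w k)) (4 * (w - 2), 7) (4 * 1 + 2, 4 * 0 + 2) := by
  have h1 := (linked_wire hk hw le_rfl (by omega)).2.trans (.move (-2) (-1)
      (tileMem_wire hk (by omega) (by omega) (by decide))
      (tileMem_wireStart hk hw (a := 3) (b := 0) (by decide)))
  exact ⟨h1, h1.trans (.move (-1) 2 (tileMem_wireStart hk hw (by decide))
    (tileMem_wireStart hk hw (by decide)))⟩

theorem linked_south (hk : 1 ≤ k) (hw : 2 * k + 5 ≤ w) {i : ℤ} (hi : 1 ≤ i) (hik : i ≤ k)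
    {j : ℤ} (hj : i ≤ j) (hj' : j ≤ w - 2 - i) {c : ℤ × ℤ}
    (hc : c ∈ (spiralTile w k j i).cells) :
    Linked (TileMem (spiralTile w k)) (4 * (w - 2), 7) (4 * j + c.1, 4 * i + c.2) := by
  have hs : spiralTile w k 1 1 = (.start, 0) := by
    obtain ⟨q, hq⟩ := exists_lowerSpec_spiralTile w k 1 (J := 1) (by omega)
    generalize spiralTile w k 1 1 = t at *
    cases hq <;> first | rfl | omega
  have h1 := (linked_wireStart hk hw).2.trans (.move (-1) 2
    (tileMem_wireStart hk hw (by decide)) (tileMem_of_mem (a := 1) (b := 0) _ hs))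
  have h2 := linked_south_aux hw le_rfl hk le_rfl (by omega) (c := (1, 0)) (by rw [hs]; decide)
  exact (h1.trans h2.symm).trans (linked_south_aux hw hi hik hj hj' hc)

theorem spiralTile_hook (hk : 1 ≤ k) (hw : 2 * k + 5 ≤ w) :
    spiralTile w k (w - 2 - k) (k + 1) = (.hook, 0) := by
  obtain ⟨q, hq⟩ := exists_lowerSpec_spiralTile w k (w - 2 - k) (J := k + 1) le_rfl
  generalize spiralTile w k (w - 2 - k) (k + 1) = t at *
  cases hq <;> first | rfl | omega

theorem spiralTile_joint (hk : 1 ≤ k) (hw : 2 * k + 5 ≤ w) :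
    spiralTile w k (w - 2 - k) (k + 2) = (.joint, 0) := by
  have := spiralTile_rotate w k (k + 1) (k + 1)
  have e1 : w - 1 - (k + 1) = w - 2 - k := by ring
  have e2 : 2 * k + 3 - (k + 1) = k + 2 := by ring
  rw [e1, e2] at this
  rw [this]
  obtain ⟨q, hq⟩ := exists_lowerSpec_spiralTile w k (k + 1) (J := k + 1) le_rfl
  generalize spiralTile w k (k + 1) (k + 1) = t at *
  cases hq <;> first | rfl | omega

theorem linked_hook (hk : 1 ≤ k) (hw : 2 * k + 5 ≤ w) {c : ℤ × ℤ}
    (hc : c ∈ Tile.cells (.hook, 0)) : Linked (TileMem (spiralTile w k)) (4 * (w - 2), 7)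
      (4 * (w - 2 - k) + c.1, 4 * (k + 1) + c.2) := by
  have hs := (isPillar_east hw hk le_rfl).start
  have h0 := linked_east hw hk le_rfl le_rfl (by omega) (c := (0, 3)) (by rw [hs]; decide)
  have m := fun a b h => tileMem_of_mem (a := a) (b := b) _ (spiralTile_hook hk hw) h
  have h1 := h0.trans (.move (-1) 2 (tileMem_of_mem _ hs) (m 3 1 (by decide)))
  have h2 := h1.trans (.move (-2) 1 (m 3 1 (by decide)) (m 1 2 (by decide)))
  obtain ⟨a, b⟩ := c
  have hc' : (a, b) ∈ [((3 : ℤ), (1 : ℤ)), (1, 2)] := hc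
  simp only [List.mem_cons, Prod.mk.injEq, List.not_mem_nil, or_false] at hc'
  obtain ⟨rfl, rfl⟩ | ⟨rfl, rfl⟩ := hc' <;> assumption

theorem linked_joint (hk : 1 ≤ k) (hw : 2 * k + 5 ≤ w) {c : ℤ × ℤ}
    (hc : c ∈ Tile.cells (.joint, 0)) : Linked (TileMem (spiralTile w k)) (4 * (w - 2), 7)
      (4 * (w - 2 - k) + c.1, 4 * (k + 2) + c.2) := by
  have h0 := linked_hook hk hw (c := (1, 2)) (by decide)
  have m := fun a b h => tileMem_of_mem (a := a) (b := b) _ (spiralTile_joint hk hw) h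
  have h1 := h0.trans (.move (-1) 2 (tileMem_of_mem _ (spiralTile_hook hk hw)) (m 0 0 (by decide)))
  have h2 := h1.trans (.move 1 2 (m 0 0 (by decide)) (m 1 2 (by decide)))
  have h3 := h2.trans (.move 2 (-1) (m 1 2 (by decide)) (m 3 1 (by decide)))
  have h4 := h3.trans (.move (-1) 2 (m 3 1 (by decide)) (m 2 3 (by decide)))
  obtain ⟨a, b⟩ := c
  have hc' : (a, b) ∈ [((0 : ℤ), (0 : ℤ)), (3, 1), (1, 2), (2, 3)] := hc
  simp only [List.mem_cons, Prod.mk.injEq, List.not_mem_nil, or_false] at hc'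
  obtain ⟨rfl, rfl⟩ | ⟨rfl, rfl⟩ | ⟨rfl, rfl⟩ | ⟨rfl, rfl⟩ := hc' <;> assumption

theorem Linked.rotate {p q : ℤ × ℤ} (h : Linked (TileMem (spiralTile w k)) p q) :
    Linked (TileMem (spiralTile w k)) ((4 * w - 1, 8 * k + 15) - p)
      ((4 * w - 1, 8 * k + 15) - q) :=
  h.map _ (fun p => (tileMem_rotate w k p).2) (fun _ _ => knightAdj_rotate_half _)

/-- The two halves of the spiral are joined. -/
theorem linked_rotate (hk : 1 ≤ k) (hw : 2 * k + 5 ≤ w) :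
    Linked (TileMem (spiralTile w k)) (4 * (w - 2), 7)
      ((4 * w - 1, 8 * k + 15) - (4 * (w - 2), 7)) := by
  have hs : spiralTile w k k k = (.start, 0) := by
    obtain ⟨q, hq⟩ := exists_lowerSpec_spiralTile w k k (J := k) (by omega)
    generalize spiralTile w k k k = t at *
    cases hq <;> first | rfl | omega
  have h1 := (linked_south hk hw hk le_rfl le_rfl (by omega) (c := (3, 3))
    (by rw [hs]; decide)).rotate
  have m1 := (tileMem_rotate w k _).2 (tileMem_of_mem (a := 3) (b := 3) _ hs)
  exact ((linked_joint hk hw (c := (2, 3)) (by decide)).trans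
    (.move 2 1 (tileMem_of_mem _ (spiralTile_joint hk hw)) m1)).trans h1.symm

/-- Each cell of the lower half is reached directly, except those of the west sides and of the lower
joint, whose half turns lie on an east side or on the upper joint. `linked_rotate` then merges the
two alternatives. -/
theorem linked_or_linked_rotate (hk : 1 ≤ k) (hw : 2 * k + 5 ≤ w) {I J : ℤ} (hJ : J ≤ k + 1)
    {c : ℤ × ℤ} (hc : c ∈ (spiralTile w k I J).cells) :
    Linked (TileMem (spiralTile w k)) (4 * (w - 2), 7) (4 * I + c.1, 4 * J + c.2) ∨
    Linked (TileMem (spiralTile w k)) (4 * (w - 2), 7)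
      ((4 * w - 1, 8 * k + 15) - (4 * I + c.1, 4 * J + c.2)) := by
  have hcr : (3 - c.1, 3 - c.2) ∈ (spiralTile w k (w - 1 - I) (2 * k + 3 - J)).cells := by
    rw [spiralTile_rotate, mem_cells_rotate]
    exact hc
  have e : ((4 * w - 1, 8 * k + 15) : ℤ × ℤ) - (4 * I + c.1, 4 * J + c.2) =
      (4 * (w - 1 - I) + (3 - c.1), 4 * (2 * k + 3 - J) + (3 - c.2)) := by
    ext <;> simp only [Prod.fst_sub, Prod.snd_sub] <;> ring
  rw [e]
  have south : 1 ≤ J → J ≤ k → J ≤ I → I ≤ w - 2 - J →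
      Linked (TileMem (spiralTile w k)) (4 * (w - 2), 7) (4 * I + c.1, 4 * J + c.2) :=
    fun h1 h2 h3 h4 => linked_south hk hw h1 h2 h3 h4 hc
  have east : w - 1 - k ≤ I → I ≤ w - 2 → w - 1 - I ≤ J → J ≤ k + 1 →
      Linked (TileMem (spiralTile w k)) (4 * (w - 2), 7) (4 * I + c.1, 4 * J + c.2) := by
    intro h1 h2 h3 h4
    obtain ⟨i, rfl⟩ : ∃ i, I = w - 1 - i := ⟨w - 1 - I, by ring⟩
    exact linked_east hw (by omega) (by omega) (by omega) (by omega) hc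
  have west : 1 ≤ I → I < J →
      Linked (TileMem (spiralTile w k)) (4 * (w - 2), 7)
        (4 * (w - 1 - I) + (3 - c.1), 4 * (2 * k + 3 - J) + (3 - c.2)) := fun h1 h2 =>
    linked_east hw h1 (by omega) (by omega) (by omega) hcr
  clear e hcr
  obtain ⟨q, hq⟩ := exists_lowerSpec_spiralTile w k I hJ
  generalize spiralTile w k I J = t at *
  obtain ⟨a, b⟩ := c
  cases hq with
  | outside h => simp [Tile.cells, Shape.cells] at hc
  | inside h => simp [Tile.cells, Shape.cells] at hc
  | wireStart h =>
    have hc' : (a, b) ∈ [((3 : ℤ), (0 : ℤ)), (2, 2)] := hc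
    simp only [List.mem_cons, Prod.mk.injEq, List.not_mem_nil, or_false] at hc'
    obtain ⟨rfl, rfl, -⟩ := h
    have := linked_wireStart hk hw
    obtain ⟨rfl, rfl⟩ | ⟨rfl, rfl⟩ := hc'
    exacts [.inl this.1, .inl this.2]
  | wireEnd h =>
    have hc' : (a, b) ∈ [((2 : ℤ), (3 : ℤ)), (0, 2)] := hc
    simp only [List.mem_cons, Prod.mk.injEq, List.not_mem_nil, or_false] at hc'
    obtain ⟨rfl, -, rfl⟩ := h
    have := linked_wireEnd hk hw
    obtain ⟨rfl, rfl⟩ | ⟨rfl, rfl⟩ := hc'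
    exacts [.inl this.1, .inl this.2]
  | wire h =>
    have hc' : (a, b) ∈ [((3 : ℤ), (0 : ℤ)), (1, 1)] := hc
    simp only [List.mem_cons, Prod.mk.injEq, List.not_mem_nil, or_false] at hc'
    obtain ⟨rfl, h1, h2⟩ := h
    have := linked_wire hk hw (I := I) (by omega) (by omega)
    obtain ⟨rfl, rfl⟩ | ⟨rfl, rfl⟩ := hc'
    exacts [.inl this.1, .inl this.2]
  | west h => exact .inr (west (by omega) (by omega))
  | westTurn h => exact .inr (west (by omega) (by omega))
  | joint h =>
    obtain ⟨rfl, -, -, rfl⟩ := h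
    have := linked_joint hk hw (c := (3 - a, 3 - b))
      ((mem_cells_rotate (t := (.joint, 2)) (c := (a, b))).2 hc)
    have e1 : w - 1 - (k + 1) = w - 2 - k := by ring
    have e2 : 2 * k + 3 - (k + 1) = k + 2 := by ring
    exact .inr (by simpa only [e1, e2] using this)
  | hook h =>
    obtain ⟨rfl, -, -, -, rfl⟩ := h
    have e1 : w - 1 - (k + 1) = w - 2 - k := by ring
    rw [e1]
    exact .inl (linked_hook hk hw hc)
  | innerEast h => exact .inl (east (by omega) (by omega) (by omega) (by omega))
  | southOuterStart h => exact .inl (south (by omega) (by omega) (by omega) (by omega))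
  | southStart h => exact .inl (south (by omega) (by omega) (by omega) (by omega))
  | south h => exact .inl (south (by omega) (by omega) (by omega) (by omega))
  | southTurn h => exact .inl (south (by omega) (by omega) (by omega) (by omega))
  | eastOuterStart h => exact .inl (east (by omega) (by omega) (by omega) (by omega))
  | eastStart h => exact .inl (east (by omega) (by omega) (by omega) (by omega))
  | east h => exact .inl (east (by omega) (by omega) (by omega) (by omega))

theorem knightConnected_spiral (hk : 1 ≤ k) (hw : 2 * k + 5 ≤ w) :
    KnightConnected (spiral w k) := by
  have hM : (fun p => p ∈ spiral w k) = TileMem (spiralTile w k) :=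
    funext fun p => propext (mem_spiral hk)
  refine knightConnected_of_linked (p := (4 * (w - 2), 7)) ?_
  rw [hM]
  have half : ∀ p ∈ spiral w k, p.2 / 4 ≤ k + 1 →
      Linked (TileMem (spiralTile w k)) (4 * (w - 2), 7) p ∧
      Linked (TileMem (spiralTile w k)) (4 * (w - 2), 7) ((4 * w - 1, 8 * k + 15) - p) := by
    intro p hp hJ
    have h := linked_or_linked_rotate hk hw hJ ((mem_spiral hk).1 hp)
    have e : ((4 * (p.1 / 4) + p.1 % 4, 4 * (p.2 / 4) + p.2 % 4) : ℤ × ℤ) = p := by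
      ext <;> simp only <;> omega
    rw [e] at h
    rcases h with h | h
    · exact ⟨h, (linked_rotate hk hw).trans h.rotate⟩
    · refine ⟨?_, h⟩
      have := (linked_rotate hk hw).trans h.rotate
      rwa [sub_sub_cancel] at this
  intro p hp
  rcases le_or_gt (p.2 / 4) (k + 1) with h | h
  · exact (half p hp h).1
  · have := (half _ ((spiral_rotate hk p).2 hp) (by rw [Prod.snd_sub]; omega)).2
    rwa [sub_sub_cancel] at this

end Spiral

/-! ### Snakes on rectangular boards -/

section Equiv

variable (f : ℤ × ℤ ≃ ℤ × ℤ)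

theorem knightDegree_map (hf : ∀ p q, KnightAdj (f p) (f q) ↔ KnightAdj p q)
    (S : Finset (ℤ × ℤ)) (v : ℤ × ℤ) :
    knightDegree (S.map f.toEmbedding) (f v) = knightDegree S v := by
  rw [knightDegree, knightDegree, Finset.filter_map, Finset.card_map]
  congr 1
  exact Finset.filter_congr fun u _ => hf v u

theorem knightAdj_prodComm (p q : ℤ × ℤ) :
    KnightAdj (Equiv.prodComm ℤ ℤ p) (Equiv.prodComm ℤ ℤ q) ↔ KnightAdj p q := by
  simp only [KnightAdj, Equiv.prodComm_apply, Prod.fst_swap, Prod.snd_swap]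
  tauto

theorem KnightConnected.map (hf : ∀ p q, KnightAdj (f p) (f q) ↔ KnightAdj p q)
    {S : Finset (ℤ × ℤ)} (hS : KnightConnected S) : KnightConnected (S.map f.toEmbedding) := by
  intro U hU hne hclosed
  have hsub : U.map f.symm.toEmbedding ⊆ S := by
    intro p hp
    obtain ⟨u, hu, rfl⟩ := Finset.mem_map.1 hp
    obtain ⟨s, hs, rfl⟩ := Finset.mem_map.1 (hU hu)
    simpa using hs
  have h := hS (U.map f.symm.toEmbedding) hsub (hne.map) ?_
  · rw [← h, Finset.map_map]
    ext p
    simp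
  · intro u hu v hv huv
    obtain ⟨u, hu', rfl⟩ := Finset.mem_map.1 hu
    refine Finset.mem_map.2 ⟨f v, hclosed u hu' _ (Finset.mem_map_of_mem _ hv) ?_, by simp⟩
    rw [← hf] at huv
    simpa using huv

/-- Allows the spiral to be translated into the board, and transposed if the board is taller than
wide. -/
theorem card_mem_snakeCycleLengths (hf : ∀ p q, KnightAdj (f p) (f q) ↔ KnightAdj p q)
    {S : Finset (ℤ × ℤ)} {B : Set (ℤ × ℤ)} (hB : ∀ p ∈ S, f p ∈ B) (hne : S.Nonempty)
    (hconn : KnightConnected S) (hdeg : ∀ v ∈ S, knightDegree S v = 2) :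
    S.card ∈ snakeCycleLengths (knightGraph B) := by
  refine mem_snakeCycleLengths.2 ⟨S.map f.toEmbedding, ?_, hne.map, hconn.map f hf, ?_,
    Finset.card_map _⟩ <;> intro p hp <;> obtain ⟨p, hp', rfl⟩ := Finset.mem_map.1 hp
  · exact hB p hp'
  · exact (knightDegree_map f hf S p).trans (hdeg p hp')

end Equiv

theorem mem_board {m n : ℕ} {p : ℤ × ℤ} :
    p ∈ board m n ↔ (0 ≤ p.1 ∧ p.1 < n) ∧ (0 ≤ p.2 ∧ p.2 < m) := Iff.rfl

/-- The eight cells around the centre of a `3 × 3` board. -/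
def ring : Finset (ℤ × ℤ) := {(0, 0), (1, 2), (2, 0), (0, 1), (2, 2), (1, 0), (0, 2), (2, 1)}

theorem eight_mem_snakeCycleLengths {m n : ℕ} (hm : 3 ≤ m) (hn : 3 ≤ n) :
    8 ∈ snakeCycleLengths (knightGraph (board m n)) := by
  refine mem_snakeCycleLengths.2 ⟨ring, ?_, by decide, ?_, by decide, by decide⟩
  · intro p hp
    have hb : ∀ p ∈ ring, (0 ≤ p.1 ∧ p.1 < 3) ∧ (0 ≤ p.2 ∧ p.2 < 3) := by decide
    have := hb p hp
    rw [mem_board]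
    omega
  · have l1 : Linked (· ∈ ring) (0, 0) (1, 2) := .move 1 2 (by decide) (by decide)
    have l2 := l1.trans (.move (c := 2) (d := 0) 1 (-2) (by decide) (by decide))
    have l3 := l2.trans (.move (c := 0) (d := 1) (-2) 1 (by decide) (by decide))
    have l4 := l3.trans (.move (c := 2) (d := 2) 2 1 (by decide) (by decide))
    have l5 := l4.trans (.move (c := 1) (d := 0) (-1) (-2) (by decide) (by decide))
    have l6 := l5.trans (.move (c := 0) (d := 2) (-1) 2 (by decide) (by decide))
    have l7 := l6.trans (.move (c := 2) (d := 1) 2 (-1) (by decide) (by decide))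
    refine knightConnected_of_linked (p := (0, 0)) fun q hq => ?_
    simp only [ring, Finset.mem_insert, Finset.mem_singleton] at hq
    obtain rfl | rfl | rfl | rfl | rfl | rfl | rfl | rfl := hq
    exacts [.refl _, l1, l2, l3, l4, l5, l6, l7]

theorem exists_long_snakeCycle_of_le (a b : ℕ) (ha : 24 ≤ a) (hab : a ≤ b) {B : Set (ℤ × ℤ)}
    (f : ℤ × ℤ ≃ ℤ × ℤ) (hf : ∀ p q, KnightAdj (f p) (f q) ↔ KnightAdj p q)
    (hB : ∀ p : ℤ × ℤ, 0 ≤ p.1 → p.1 < b → 0 ≤ p.2 → p.2 < a → f p ∈ B) :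
    ∃ l ∈ snakeCycleLengths (knightGraph B), a * b ≤ 2 * l + 24 * (a + b) := by
  -- The largest parameters that fit: the spiral occupies `8 * k + 16` rows and, once the empty
  -- first column of tiles is shifted away, `4 * (w - 2)` columns. Here `24 ≤ a` gives `1 ≤ k`, and
  -- `a ≤ b` gives `2 * k + 5 ≤ w`.
  obtain ⟨k, hk⟩ : ∃ k : ℤ, k = a / 8 - 2 := ⟨_, rfl⟩
  obtain ⟨w, hw⟩ : ∃ w : ℤ, w = b / 4 + 2 := ⟨_, rfl⟩
  have hk1 : 1 ≤ k := by omega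
  have hw1 : 2 * k + 5 ≤ w := by omega
  have hcard := le_card_spiral hk1 hw1
  have hpos : 0 < (spiral w k).card := by
    have : 0 < k * (w - 6) := mul_pos (by omega) (by omega)
    omega
  refine ⟨(spiral w k).card, card_mem_snakeCycleLengths ((Equiv.subRight (4, 0)).trans f) ?_ ?_
    (Finset.card_pos.1 hpos) (knightConnected_spiral hk1 hw1)
    fun v hv => knightDegree_spiral hk1 hw1 hv, ?_⟩
  · intro p q
    rw [Equiv.trans_apply, Equiv.trans_apply, hf]
    simp [KnightAdj]
  · intro p hp
    have hp := (Finset.mem_filter.1 hp).1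
    simp only [Finset.mem_product, Finset.mem_Ico] at hp
    refine hB _ ?_ ?_ ?_ ?_ <;>
      simp only [Equiv.subRight_apply, Prod.fst_sub, Prod.snd_sub] <;> omega
  · have h1 : (a : ℤ) - 23 ≤ 8 * k := by omega
    have h2 : (b : ℤ) - 19 ≤ 4 * (w - 6) := by omega
    have h3 : ((a : ℤ) - 23) * (b - 19) ≤ (8 * k) * (4 * (w - 6)) :=
      mul_le_mul h1 h2 (by omega) (by omega)
    zify
    linarith

theorem exists_long_snakeCycle {m n : ℕ} (hm : 3 ≤ m) (hn : 3 ≤ n) :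
    ∃ l ∈ snakeCycleLengths (knightGraph (board m n)), m * n ≤ 2 * l + 24 * (m + n) := by
  by_cases h : 24 ≤ m ∧ 24 ≤ n
  · rcases le_total m n with hmn | hmn
    · exact exists_long_snakeCycle_of_le m n h.1 hmn (Equiv.refl _) (fun _ _ => Iff.rfl)
        fun p h1 h2 h3 h4 => ⟨⟨h1, h2⟩, h3, h4⟩
    · rw [mul_comm m n, add_comm m n]
      exact exists_long_snakeCycle_of_le n m h.2 hmn (Equiv.prodComm ℤ ℤ) knightAdj_prodComm
        fun p h1 h2 h3 h4 => ⟨⟨h3, h4⟩, h1, h2⟩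
  · refine ⟨8, eight_mem_snakeCycleLengths hm hn, ?_⟩
    rw [not_and_or] at h
    rcases h with h | h
    · have : m * n ≤ 24 * n := Nat.mul_le_mul_right _ (by omega)
      omega
    · have : m * n ≤ m * 24 := Nat.mul_le_mul_left _ (by omega)
      omega

theorem exists_long_snakePath {m n : ℕ} (hm : 1 ≤ m) (hn : 1 ≤ n) :
    ∃ l ∈ snakePathLengths (knightGraph (board m n)), m * n ≤ 2 * l + 26 * (m + n) := by
  by_cases h : 3 ≤ m ∧ 3 ≤ n
  · obtain ⟨l, hl, hle⟩ := exists_long_snakeCycle h.1 h.2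
    exact ⟨l - 2, sub_two_mem_snakePathLengths hl, by omega⟩
  · refine ⟨0, zero_mem_snakePathLengths (p := (0, 0)) ?_, ?_⟩
    · rw [mem_board]
      omega
    · rw [not_and_or] at h
      rcases h with h | h
      · have : m * n ≤ 3 * n := Nat.mul_le_mul_right _ (by omega)
        omega
      · have : m * n ≤ m * 3 := Nat.mul_le_mul_left _ (by omega)
        omega

/-! ### Extremal lengths and boards without snake cycles -/

theorem two_mul_le_of_mem_snakeCycleLengths {m n l : ℕ}
    (hl : l ∈ snakeCycleLengths (knightGraph (board m n))) : 2 * l ≤ (n + 6) * (m + 6) := by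
  obtain ⟨S, hB, -, hconn, hdeg, rfl⟩ := mem_snakeCycleLengths.1 hl
  exact two_mul_card_le (fun v hv => (hdeg v hv).le) hconn hB

theorem two_mul_le_of_mem_snakePathLengths {m n l : ℕ}
    (hl : l ∈ snakePathLengths (knightGraph (board m n))) : 2 * l ≤ (n + 6) * (m + 6) := by
  obtain ⟨S, hB, hconn, hdeg, h⟩ := exists_of_mem_snakePathLengths hl
  have := two_mul_card_le hdeg hconn hB
  omega

/-- The constant 13 is half of 26 for the lower bound; for the upper one, `3 * (m + n) + 18` is at
most `12 * (m + n)` because `m + n ≥ 2`. -/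
theorem exists_isGreatest_abs_sub_le {A : Set ℕ} {m n : ℕ} (hm : 1 ≤ m) (hn : 1 ≤ n)
    (hub : ∀ l ∈ A, 2 * l ≤ (n + 6) * (m + 6)) (hlb : ∃ l ∈ A, m * n ≤ 2 * l + 26 * (m + n)) :
    ∃ l : ℕ, IsGreatest A l ∧ |(l : ℝ) - (m : ℝ) * (n : ℝ) / 2| ≤ 13 * ((m : ℝ) + (n : ℝ)) := by
  obtain ⟨a, ha, hle⟩ := hlb
  have hbdd : BddAbove A := ⟨(n + 6) * (m + 6), fun l hl => by have := hub l hl; omega⟩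
  refine ⟨sSup A, ⟨Nat.sSup_mem ⟨a, ha⟩ hbdd, fun l hl => le_csSup hbdd hl⟩, ?_⟩
  have h1 : 2 * ((sSup A : ℕ) : ℝ) ≤ (n + 6) * (m + 6) :=
    mod_cast hub _ (Nat.sSup_mem ⟨a, ha⟩ hbdd)
  have h2 : (m * n : ℝ) ≤ 2 * a + 26 * (m + n) := mod_cast hle
  have h3 : (a : ℝ) ≤ (sSup A : ℕ) := mod_cast le_csSup hbdd ha
  have h4 : (1 : ℝ) ≤ m := mod_cast hm
  have h5 : (1 : ℝ) ≤ n := mod_cast hn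
  rw [abs_le]
  constructor <;> linarith

/-- In two rows every move shifts the column by two and changes the row, so a rightmost cell has
only one possible neighbour. -/
theorem exists_knightDegree_le_one {S : Finset (ℤ × ℤ)} (hne : S.Nonempty)
    (hS : ∀ p ∈ S, 0 ≤ p.2 ∧ p.2 < 2) : ∃ v ∈ S, knightDegree S v ≤ 1 := by
  obtain ⟨v, hv, hmax⟩ := S.exists_max_image Prod.fst hne
  refine ⟨v, hv, Finset.card_le_one.2 ?_⟩
  have key : ∀ u ∈ S.filter (KnightAdj v), u.1 = v.1 - 2 ∧ u.2 = 1 - v.2 := by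
    intro u hu
    obtain ⟨hu, hadj⟩ := Finset.mem_filter.1 hu
    have h1 := hS u hu
    have h2 := hS v hv
    have h3 := hmax u hu
    simp only [KnightAdj, abs_eq (zero_le_one (α := ℤ)), abs_eq (zero_le_two (α := ℤ))] at hadj
    omega
  intro u hu u' hu'
  have h1 := key u hu
  have h2 := key u' hu'
  ext <;> omega

theorem snakeCycleLengths_eq_empty {m n : ℕ} (h : m < 3 ∨ n < 3) :
    snakeCycleLengths (knightGraph (board m n)) = ∅ := by
  refine Set.eq_empty_of_forall_notMem fun l hl => ?_
  obtain ⟨S, hB, hne, -, hdeg, -⟩ := mem_snakeCycleLengths.1 hl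
  rcases h with h | h
  · obtain ⟨v, hv, hle⟩ := exists_knightDegree_le_one hne fun p hp => by
      have := mem_board.1 (hB p hp)
      omega
    rw [hdeg v hv] at hle
    omega
  · obtain ⟨v, hv, hle⟩ := exists_knightDegree_le_one
      (S := S.map (Equiv.prodComm ℤ ℤ).toEmbedding) hne.map fun p hp => by
        obtain ⟨p, hp', rfl⟩ := Finset.mem_map.1 hp
        have := mem_board.1 (hB p hp')
        simp only [Equiv.coe_toEmbedding, Equiv.prodComm_apply, Prod.snd_swap]
        omega
    obtain ⟨v, hv', rfl⟩ := Finset.mem_map.1 hv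
    have := (knightDegree_map _ knightAdj_prodComm S v).symm.trans_le hle
    rw [hdeg v hv'] at this
    omega

end Snake

theorem theorem4 :
    ∃ C : ℝ, ∀ m n : ℕ, 1 ≤ m → 1 ≤ n →
      (∃ l : ℕ, IsGreatest (Snake.snakePathLengths (Snake.knightGraph (Snake.board m n))) l ∧
        |(l : ℝ) - (m : ℝ) * (n : ℝ) / 2| ≤ C * ((m : ℝ) + (n : ℝ))) ∧
      (3 ≤ m → 3 ≤ n →
        ∃ l : ℕ, IsGreatest (Snake.snakeCycleLengths (Snake.knightGraph (Snake.board m n))) l ∧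
          |(l : ℝ) - (m : ℝ) * (n : ℝ) / 2| ≤ C * ((m : ℝ) + (n : ℝ))) ∧
      (m < 3 ∨ n < 3 →
        Snake.snakeCycleLengths (Snake.knightGraph (Snake.board m n)) = ∅) := by
  refine ⟨13, fun m n hm hn => ⟨?_, fun hm3 hn3 => ?_, Snake.snakeCycleLengths_eq_empty⟩⟩
  · exact Snake.exists_isGreatest_abs_sub_le hm hn
      (fun _ => Snake.two_mul_le_of_mem_snakePathLengths) (Snake.exists_long_snakePath hm hn)
  · obtain ⟨l, hl, hle⟩ := Snake.exists_long_snakeCycle hm3 hn3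
    exact Snake.exists_isGreatest_abs_sub_le hm hn
      (fun _ => Snake.two_mul_le_of_mem_snakeCycleLengths) ⟨l, hl, by omega⟩
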